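/- **Setting.** Let $K\ge 1$, $1\le k\le K$, and let $P,Q\ge 1$ be integers, $p\in\{1,\dots,P\}$. A base station serves $K$ users through a reconfigurable intelligent surface with $PQ$ elements under on-off control; an external eavesdropper listens. With $\mathbf V=\mathbf I_P\otimes\mathbf 1_Q$ and $\mathbf v_p$ its $p$-th column, the cascaded channels are $H_k=\mathbf v_p^H\mathrm{diag}(\mathbf h_{rk}^H)\mathbf h_{br}$ and $H_e=\mathbf v_p^H\mathrm{diag}(\mathbf h_{re}^H)\mathbf h_{br}$, where $\mathbf h_{br},\mathbf h_{rk},\mathbf h_{re}$ are independent with i.i.d. entries of law $\mathcal{CN}(0,N_{br})$, $\mathcal{CN}(0,N_{rk})$, $\mathcal{CN}(0,N_{re})$. Let $h_{ipu}\sim\mathcal{CN}(0,N_{ipu})$ and $h_{ipe}\sim\mathcal{CN}(0,N_{ipe})$ be the residual interference channels at the users and at the eavesdropper. All variances, the eavesdropper SNR $\rho_e$ and the target secrecy rate $R_k$ are positive; $a_1,\dots,a_K\ge 0$ are the power coefficients and $\nu_k=\sum_{i>k}a_i$. The level of residual interference is $\varpi\ge 0$: $\varpi=0$ is perfect SIC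 (pSIC), $\varpi>0$ is imperfect SIC (ipSIC). The ordered gain $G_k$ of user $k$ is the $k$-th smallest of $K$ independent copies of $|H_k|^2$, and $G_k,h_{ipu},h_{ipe}$ are independent. The gain of the eavesdropper is replaced by its mean $\bar g=\mathbb E|H_e|^2$. At transmit SNR $\rho>0$ put $$\gamma_k=\frac{\rho G_ka_k}{\rho G_k\nu_k+\varpi\rho|h_{ipu}|^2+1},\qquad \gamma_e=\frac{\bar g\,a_k\rho_e}{\rho_e\bar g\,\nu_k+\varpi\rho_e|h_{ipe}|^2+1},$$ and let the secrecy outage probability (SOP) be $$P_{out,k}(\rho)=\Pr\big([\log_2(1+\gamma_k)-\log_2(1+\gamma_e)]^+<R_k\big).$$ **Notation.** $\kappa=\frac{K!}{(K-k)!(k-1)!}$; $K_Q$ is the modified Bessel function of the second kind; $L_n(x)=e^x\frac{d^n}{dx^n}(x^ne^{-x})$ is the Laguerre polynomial, with zeros $\tau_1^{(n)},\dots,\tau_n^{(n)}$ and Gauss-Laguerre weights $G_i^{(n)}=\frac{(n!)^2}{\tau_i^{(n)}[L_n'(\tau_i^{(n)})]^2}$; $$\eta(\tau)=2^{R_k}\Big(1+\frac{QN_{br}N_{re}a_k\rho_e}{\rho_eQN_{br}N_{re}\nu_k+\varpi\rho_eN_{ipe}\tau+1}\Big)-1,\qquad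 \psi=2^{R_k}\Big(1+\frac{QN_{br}N_{re}a_k\rho_e}{\rho_eQN_{br}N_{re}\nu_k+1}\Big)-1,$$ $$s(\psi)=\frac{\psi}{\rho N_{br}N_{rk}(a_k-\psi\nu_k)},\qquad B(z)=1-\frac{2}{\Gamma(Q)}z^{Q/2}K_Q(2\sqrt z).$$ Assume that the threshold is attainable: $\psi\nu_k<a_k$. **ipSIC.** Let $\varpi>0$. For integers $S,D$, let $$P^{ip}_{S,D}(\rho)=\sum_{i=1}^{S}\sum_{l=0}^{K-k}\sum_{d=1}^{D}\kappa\,G_i^{(S)}G_d^{(D)}\binom{K-k}{l}\frac{(-1)^l}{k+l}\,B\Big(\frac{\eta(\tau_i^{(S)})\,(\varpi\rho N_{ipu}\tau_d^{(D)}+1)}{(a_k-\eta(\tau_i^{(S)})\nu_k)\,\rho N_{br}N_{rk}}\Big)^{k+l}$$ be the approximate SOP, and let $$P^{ip,asy}_{S,D}=\sum_{i=1}^{S}\sum_{l=0}^{K-k}\sum_{d=1}^{D}\kappa\,G_i^{(S)}G_d^{(D)}\binom{K-k}{l}\frac{(-1)^l}{k+l}\,B\Big(\frac{\eta(\tau_i^{(S)})\,N_{ipu}\varpi\tau_d^{(D)}}{(a_k-\eta(\tau_i^{(S)})\nu_k)N_{br}N_{rk}}\Big)^{k+l}.$$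 Then 1. $\lim_{\rho\to\infty}P^{ip}_{S,D}(\rho)=P^{ip,asy}_{S,D}$ for all $S,D$; 2. $P^{ip,asy}_{S,D}>0$ for all $S,D\ge 1$; 3. there is a number $L>0$ with $\lim_{\rho\to\infty}P_{out,k}(\rho)=L$ and $\lim_{S,D\to\infty}P^{ip,asy}_{S,D}=L$. **pSIC.** Let $\varpi=0$. As $\rho\to\infty$ (so $s(\psi)\to0$), both the SOP $P_{out,k}(\rho)$ and the closed form $\kappa\sum_{l=0}^{K-k}\binom{K-k}{l}\frac{(-1)^l}{k+l}B(s(\psi))^{k+l}$ are asymptotically equivalent (ratio tending to $1$) to $$\frac{\kappa}{k}\Big(1-\frac{1}{\Gamma(Q)}\{1+s(\psi)\ln s(\psi)\}\Big)^k\ \text{ if } Q=1,\qquad\text{and to}\qquad \frac{\kappa}{k}\Big(\frac{s(\psi)}{Q-1}\Big)^k\ \text{ if } Q\ge2 .$$ -/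

import Mathlib

open MeasureTheory ProbabilityTheory Filter Topology
open scoped Kronecker

noncomputable section

namespace RISNOMA

/-! ### Special functions and Gauss-Laguerre quadrature -/

/-- The modified Bessel function of the second kind of integer order,
`K_n(x) = ∫₀^∞ exp(-x cosh t) cosh(n t) dt`, for `x > 0`. -/
def besselK (n : ℕ) (x : ℝ) : ℝ :=
  ∫ t in Set.Ioi (0 : ℝ), Real.exp (-x * Real.cosh t) * Real.cosh (n * t)

/-- The Laguerre polynomial in the normalisation `L_n(x) = eˣ (d/dx)ⁿ (xⁿ e⁻ˣ)`, so `L_n(0) = n!`.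
This is the normalisation for which the weights below have the numerator `(n!)²`. -/
def laguerre (n : ℕ) : Polynomial ℝ :=
  ∑ j ∈ Finset.range (n + 1),
    Polynomial.monomial j ((-1 : ℝ) ^ j * (n.choose j : ℝ) * (n.factorial : ℝ) / (j.factorial : ℝ))

/-- The zeros `τ` of `L_n`, i.e. the nodes of the `n`-point Gauss-Laguerre rule. -/
def laguerreNodes (n : ℕ) : Finset ℝ := (laguerre n).roots.toFinset

/-- The weight `(n!)² / (τ (L_n'(τ))²)` of the `n`-point Gauss-Laguerre rule at the node `τ`. -/
def laguerreWeight (n : ℕ) (τ : ℝ) : ℝ :=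
  (n.factorial : ℝ) ^ 2 / (τ * ((laguerre n).derivative.eval τ) ^ 2)

/-! ### Fading channels under on-off control -/

/-- The circularly symmetric complex Gaussian law `CN(0, N)`: independent real and imaginary
parts, each of variance `N / 2`. -/
def complexGaussian (N : ℝ) : Measure ℂ :=
  ((gaussianReal 0 (N / 2).toNNReal).prod (gaussianReal 0 (N / 2).toNNReal)).map
    (fun z : ℝ × ℝ => (⟨z.1, z.2⟩ : ℂ))

/-- The law of a vector of `M = PQ` independent `CN(0, N)` entries. -/
def channelLaw (P Q : ℕ) (N : ℝ) : Measure (Fin P × Fin Q → ℂ) :=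
  Measure.pi (fun _ => complexGaussian N)

/-- The on-off matrix `V = I_P ⊗ 1_Q`. -/
def onOffMatrix (P Q : ℕ) : Matrix (Fin P × Fin Q) (Fin P × Unit) ℂ :=
  (1 : Matrix (Fin P) (Fin P) ℂ) ⊗ₖ (Matrix.of fun (_ : Fin Q) (_ : Unit) => (1 : ℂ))

/-- The cascaded channel `v_pᴴ D_r h_br`, where `v_p` is the `p`-th column of `V` and `D_r` is the
diagonal matrix with the entries of `h_rᴴ`. -/
def cascadedChannel {P Q : ℕ} (p : Fin P) (hr hbr : Fin P × Fin Q → ℂ) : ℂ :=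
  star (fun m => onOffMatrix P Q m (p, ())) ⬝ᵥ
    Matrix.mulVec (Matrix.diagonal (star hr)) hbr

/-- The law of the cascaded channel gain `|v_pᴴ D_r h_br|²` for independent Rayleigh fading
`h_br` (variance `Nbr`) and `h_r` (variance `Nr`). -/
def cascadedGainLaw {P : ℕ} (Q : ℕ) (p : Fin P) (Nbr Nr : ℝ) : Measure ℝ :=
  ((channelLaw P Q Nbr).prod (channelLaw P Q Nr)).map
    (fun h => ‖cascadedChannel p h.2 h.1‖ ^ 2)

/-- The entry of rank `k` of a tuple listed in nondecreasing order. -/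
def orderStat {K : ℕ} (k : Fin K) (x : Fin K → ℝ) : ℝ := x (Tuple.sort x k)

/-- The law of the order statistic of rank `k` of `K` independent samples from `ν`. -/
def orderedLaw {K : ℕ} (k : Fin K) (ν : Measure ℝ) : Measure ℝ :=
  (Measure.pi (fun _ : Fin K => ν)).map (orderStat k)

/-! ### The network -/

/-- Parameters of a RIS-NOMA downlink with `K` users, an RIS with `P * Q` elements under on-off
control, and an external eavesdropper. Users are indexed by `Fin K`: the index `k` is the user
with the number `k + 1`, in increasing order of the cascaded channel gain. -/
structure Network (K : ℕ) where
  /-- number of columns of the on-off matrix -/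
  P : ℕ
  /-- number of RIS elements that are switched on -/
  Q : ℕ
  /-- the column in use -/
  p : Fin P
  /-- power allocation coefficients -/
  a : Fin K → ℝ
  /-- variance of the BS-RIS channel -/
  Nbr : ℝ
  /-- variances of the RIS-user channels -/
  Nr : Fin K → ℝ
  /-- variance of the RIS-eavesdropper channel -/
  Nre : ℝ
  /-- variance of the residual interference channel at the users -/
  Nipu : ℝ
  /-- variance of the residual interference channel at the eavesdropper -/
  Nipe : ℝ
  /-- transmit SNR of the eavesdropping channel -/
  ρe : ℝ
  /-- target secrecy rates -/
  R : Fin K → ℝ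
  Q_pos : 1 ≤ Q
  a_nonneg : ∀ i, 0 ≤ a i
  Nbr_pos : 0 < Nbr
  Nr_pos : ∀ i, 0 < Nr i
  Nre_pos : 0 < Nre
  Nipu_pos : 0 < Nipu
  Nipe_pos : 0 < Nipe
  ρe_pos : 0 < ρe
  R_pos : ∀ i, 0 < R i

/-- The secrecy rate `[log₂(1 + γ) - log₂(1 + γe)]⁺`. -/
def secrecyRate (γ γe : ℝ) : ℝ := max (Real.logb 2 (1 + γ) - Real.logb 2 (1 + γe)) 0

namespace Network

variable {K : ℕ} (net : Network K)

/-- The total power `ν_k` of the users after user `k`. -/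
def tail (k : Fin K) : ℝ := ∑ i ∈ Finset.Ioi k, net.a i

/-- SINR of user `k` for its own signal, with channel gain `g` and residual interference gain `y`,
at transmit SNR `ρ` and residual interference level `ϖ`. -/
def userSINR (ϖ ρ : ℝ) (k : Fin K) (g y : ℝ) : ℝ :=
  ρ * g * net.a k / (ρ * g * net.tail k + ϖ * ρ * y + 1)

/-- SINR of the eavesdropper for the signal of user `k`, with channel gain `g` and residual
interference gain `y`. -/
def eveSINR (ϖ : ℝ) (k : Fin K) (g y : ℝ) : ℝ :=
  g * net.a k * net.ρe / (net.ρe * g * net.tail k + ϖ * net.ρe * y + 1)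

/-- The mean `E|H_e|²` of the cascaded channel gain of the eavesdropper. -/
def meanEveGain : ℝ := ∫ g, g ∂(cascadedGainLaw net.Q net.p net.Nbr net.Nre)

/-- The law of the ordered channel gain of user `k`: the order statistic of rank `k` of `K`
independent samples of `|H_k|²`. -/
def userGainLaw (k : Fin K) : Measure ℝ :=
  orderedLaw k (cascadedGainLaw net.Q net.p net.Nbr (net.Nr k))

/-- The secrecy outage probability `P(C_k < R_k)` of user `k` under external eavesdropping, the
channel gain of the eavesdropper being replaced by its mean. The level `ϖ = 0` is perfect SIC,
a level `ϖ > 0` is imperfect SIC. -/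
def SOP (ϖ : ℝ) (k : Fin K) (ρ : ℝ) : ℝ :=
  ((net.userGainLaw k).prod
      ((complexGaussian net.Nipu).prod (complexGaussian net.Nipe))).real
    {z : ℝ × ℂ × ℂ |
      secrecyRate (net.userSINR ϖ ρ k z.1 (‖z.2.1‖ ^ 2))
        (net.eveSINR ϖ k net.meanEveGain (‖z.2.2‖ ^ 2)) < net.R k}

/-- `κ = K! / ((K - k)! (k - 1)!)` for the user with the number `k + 1`. -/
def kappa (_net : Network K) (k : Fin K) : ℝ :=
  (K.factorial : ℝ) / (((K - (k + 1)).factorial : ℝ) * ((k : ℕ).factorial : ℝ))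

/-- The threshold `η(τ)` on the SINR of user `k`, at the node `τ`. -/
def eta (ϖ : ℝ) (k : Fin K) (τ : ℝ) : ℝ :=
  (2 : ℝ) ^ net.R k * (1 + net.Q * net.Nbr * net.Nre * net.a k * net.ρe /
    (net.ρe * net.Q * net.Nbr * net.Nre * net.tail k + ϖ * net.ρe * net.Nipe * τ + 1)) - 1

/-- The threshold `ψ` for perfect SIC. -/
def psi (k : Fin K) : ℝ :=
  (2 : ℝ) ^ net.R k * (1 + net.Q * net.Nbr * net.Nre * net.a k * net.ρe /
    (net.ρe * net.Q * net.Nbr * net.Nre * net.tail k + 1)) - 1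

/-- `ζ₁ = (ϖ ρ N_ipu τ + 1) / (ρ N_br N_rk)`. -/
def zeta1 (ϖ ρ : ℝ) (k : Fin K) (τ : ℝ) : ℝ :=
  (ϖ * ρ * net.Nipu * τ + 1) / (ρ * net.Nbr * net.Nr k)

/-- `s(ψ) = ψ ζ₂⁻¹ / (a_k - ψ ν_k)` with `ζ₂ = ρ N_br N_rk`. -/
def sPsi (k : Fin K) (ρ : ℝ) : ℝ :=
  net.psi k * (ρ * net.Nbr * net.Nr k)⁻¹ / (net.a k - net.psi k * net.tail k)

/-- The approximate secrecy outage probability with imperfect SIC, by Gauss-Laguerre rules with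
`S` and `D` nodes, at transmit SNR `ρ`. -/
def sopIpSIC (ϖ : ℝ) (k : Fin K) (S D : ℕ) (ρ : ℝ) : ℝ :=
  ∑ σ ∈ laguerreNodes S, ∑ l ∈ Finset.range (K - (k + 1) + 1), ∑ τ ∈ laguerreNodes D,
    net.kappa k * laguerreWeight S σ * laguerreWeight D τ *
      ((K - (k + 1)).choose l : ℝ) * ((-1 : ℝ) ^ l / ((k : ℝ) + 1 + l)) *
      (1 - 2 / Real.Gamma net.Q *
        (net.eta ϖ k σ * net.zeta1 ϖ ρ k τ /
          (net.a k - net.eta ϖ k σ * net.tail k)) ^ ((net.Q : ℝ) / 2) *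
        besselK net.Q (2 * √(net.eta ϖ k σ * net.zeta1 ϖ ρ k τ /
          (net.a k - net.eta ϖ k σ * net.tail k)))) ^ ((k : ℕ) + 1 + l)

/-- The asymptotic secrecy outage probability with imperfect SIC, by Gauss-Laguerre rules with
`S` and `D` nodes. -/
def asySopIpSIC (ϖ : ℝ) (k : Fin K) (S D : ℕ) : ℝ :=
  ∑ σ ∈ laguerreNodes S, ∑ l ∈ Finset.range (K - (k + 1) + 1), ∑ τ ∈ laguerreNodes D,
    net.kappa k * laguerreWeight S σ * laguerreWeight D τ *
      ((K - (k + 1)).choose l : ℝ) * ((-1 : ℝ) ^ l / ((k : ℝ) + 1 + l)) *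
      (1 - 2 / Real.Gamma net.Q *
        (net.eta ϖ k σ * net.Nipu * ϖ * τ /
          ((net.a k - net.eta ϖ k σ * net.tail k) * net.Nbr * net.Nr k)) ^ ((net.Q : ℝ) / 2) *
        besselK net.Q (2 * √(net.eta ϖ k σ * net.Nipu * ϖ * τ /
          ((net.a k - net.eta ϖ k σ * net.tail k) * net.Nbr * net.Nr k)))) ^ ((k : ℕ) + 1 + l)

/-- The secrecy outage probability with perfect SIC in closed form. -/
def sopPSIC (k : Fin K) (ρ : ℝ) : ℝ :=
  net.kappa k * ∑ l ∈ Finset.range (K - (k + 1) + 1),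
    ((K - (k + 1)).choose l : ℝ) * ((-1 : ℝ) ^ l / ((k : ℝ) + 1 + l)) *
      (1 - 2 / Real.Gamma net.Q * (net.sPsi k ρ) ^ ((net.Q : ℝ) / 2) *
        besselK net.Q (2 * √(net.sPsi k ρ))) ^ ((k : ℕ) + 1 + l)

/-- The asymptotic secrecy outage probability with perfect SIC for `Q = 1`. -/
def asySopPSICOne (k : Fin K) (ρ : ℝ) : ℝ :=
  net.kappa k / ((k : ℝ) + 1) *
    (1 - 1 / Real.Gamma net.Q * (1 + net.sPsi k ρ * Real.log (net.sPsi k ρ))) ^ ((k : ℕ) + 1)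

/-- The asymptotic secrecy outage probability with perfect SIC for `Q ≥ 2`. -/
def asySopPSICTwo (k : Fin K) (ρ : ℝ) : ℝ :=
  net.kappa k / ((k : ℝ) + 1) * (net.sPsi k ρ / ((net.Q : ℝ) - 1)) ^ ((k : ℕ) + 1)

end Network

end RISNOMA

end

noncomputable section

namespace RISNOMA

/-! ### Gamma laws of integer shape -/

section GammaLaw

variable {E : Type*} [NormedAddCommGroup E] [NormedSpace ℝ E]

/-! Let F be the distribution function of the ordered gain divided by N_br N_rk (`gainCdf`). Given
the residual interference, outage means that the gain lies below an explicit threshold; ψν_k < a_k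
keeps the denominator of that threshold positive. The normalised interference gains are independent
Exp(1) variables, so the SOP is the integral of F(threshold) against Exp(1) ⊗ Exp(1)
(`SOP_eq_integral`), and both quadrature formulas are Gauss-Laguerre sums of the same function
(`sopIpSIC_eq`, `asySopIpSIC_eq`). The transmit SNR enters only through δ = 1/ρ, and F(threshold) is
bounded and continuous. Hence ρ → ∞ amounts to δ → 0, under a finite sum or by dominated
convergence. For ϖ > 0 the threshold at δ = 0 is still positive, and this gives the positive floor
L.

F is explicit. Given the RIS-user channel, the cascaded channel is complex Gaussian with variance
proportional to a gamma variable of shape Q. The tail of the gain is therefore E exp(-z/Y), which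
the substitution y = √z eᵘ turns into the Bessel expression. Ordering the gains gives a binomial
tail, equal to the alternating sum over l because both have the same derivative and vanish at 0.

The limit S, D → ∞ is weak convergence of the quadrature measures to Exp(1). Orthogonality of the
Laguerre polynomials gives n distinct positive nodes, positive weights of the stated form and
exactness below degree 2n. Each moment is thus eventually equal to j!, and these moments grow slowly
enough for Taylor expansion in short steps to carry convergence to the whole characteristic
function.

For ϖ = 0 the threshold is the constant s(ψ), so the SOP equals F(s(ψ)) exactly. Near 0, F is
equivalent to κ/k times the k-th power of the unordered distribution function. The latter behaves as
s E[1/Y] = s/(Q-1) for Q ≥ 2; for Q = 1 this mean is infinite and -s ln s takes its place. -/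

lemma integrableOn_pow_mul_exp_neg (m : ℕ) :
    IntegrableOn (fun x : ℝ => x ^ m * Real.exp (-x)) (Set.Ioi 0) := by
  have h := Real.GammaIntegral_convergent (s := (m : ℝ) + 1) (by positivity)
  refine h.congr_fun (fun x _ => ?_) measurableSet_Ioi
  simp [mul_comm]

lemma integral_pow_mul_exp_neg (m : ℕ) :
    ∫ x in Set.Ioi (0 : ℝ), x ^ m * Real.exp (-x) = m.factorial := by
  rw [← Real.Gamma_nat_eq_factorial, Real.Gamma_eq_integral (by positivity)]
  refine setIntegral_congr_fun measurableSet_Ioi fun x _ => ?_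
  simp [mul_comm]

/-- The gamma law of shape `m + 1` and rate `1`. -/
def gammaLaw (m : ℕ) : Measure ℝ :=
  (volume.restrict (Set.Ioi 0)).withDensity
    fun x => ENNReal.ofReal (x ^ m * Real.exp (-x) / m.factorial)

lemma gammaLaw_density_nonneg (m : ℕ) {x : ℝ} (hx : 0 < x) :
    0 ≤ x ^ m * Real.exp (-x) / m.factorial := by positivity

lemma measurable_gammaLaw_density (m : ℕ) :
    Measurable fun x : ℝ => ENNReal.ofReal (x ^ m * Real.exp (-x) / m.factorial) := by
  fun_prop

lemma integral_gammaLaw (m : ℕ) (f : ℝ → E) :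
    ∫ x, f x ∂gammaLaw m =
      ∫ x in Set.Ioi (0 : ℝ), (x ^ m * Real.exp (-x) / m.factorial) • f x := by
  rw [gammaLaw, integral_withDensity_eq_integral_toReal_smul
    (measurable_gammaLaw_density m) (ae_of_all _ fun _ => ENNReal.ofReal_lt_top)]
  refine setIntegral_congr_fun measurableSet_Ioi fun x hx => ?_
  simp only [ENNReal.toReal_ofReal (gammaLaw_density_nonneg m hx)]

lemma integrable_gammaLaw_iff (m : ℕ) (f : ℝ → E) :
    Integrable f (gammaLaw m) ↔
      IntegrableOn (fun x => (x ^ m * Real.exp (-x) / m.factorial) • f x) (Set.Ioi (0 : ℝ)) := by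
  rw [gammaLaw, integrable_withDensity_iff_integrable_smul' (measurable_gammaLaw_density m)
    (ae_of_all _ fun _ => ENNReal.ofReal_lt_top)]
  refine integrableOn_congr_fun (fun x hx => ?_) measurableSet_Ioi
  simp only [ENNReal.toReal_ofReal (gammaLaw_density_nonneg m hx)]

instance (m : ℕ) : IsProbabilityMeasure (gammaLaw m) := by
  constructor
  rw [gammaLaw, withDensity_apply _ MeasurableSet.univ, Measure.restrict_univ,
    ← ofReal_integral_eq_lintegral_ofReal ((integrableOn_pow_mul_exp_neg m).div_const _)
      ((ae_restrict_iff' measurableSet_Ioi).2 (ae_of_all _ fun x hx =>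
        gammaLaw_density_nonneg m hx)),
    integral_div, integral_pow_mul_exp_neg, div_self (by positivity), ENNReal.ofReal_one]

lemma ae_gammaLaw_pos (m : ℕ) : ∀ᵐ x ∂gammaLaw m, 0 < x :=
  (withDensity_absolutelyContinuous _ _).ae_le
    ((ae_restrict_iff' measurableSet_Ioi).2 (ae_of_all _ fun _ hx => hx))

lemma integrable_pow_gammaLaw (m j : ℕ) : Integrable (fun x => x ^ j) (gammaLaw m) := by
  rw [integrable_gammaLaw_iff]
  refine IntegrableOn.congr_fun (Integrable.div_const (integrableOn_pow_mul_exp_neg (m + j))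
    (m.factorial : ℝ)) (fun x _ => ?_) measurableSet_Ioi
  simp only [smul_eq_mul, pow_add]
  ring

lemma integral_pow_gammaLaw_zero (j : ℕ) : ∫ x : ℝ, x ^ j ∂gammaLaw 0 = j.factorial := by
  rw [integral_gammaLaw, ← integral_pow_mul_exp_neg j]
  refine setIntegral_congr_fun measurableSet_Ioi fun x _ => ?_
  simp [mul_comm (Real.exp _)]

end GammaLaw

/-! ### The Laguerre functional -/

lemma integrable_eval_gammaLaw (m : ℕ) (p : Polynomial ℝ) :
    Integrable (fun x => p.eval x) (gammaLaw m) := by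
  simp_rw [Polynomial.eval_eq_sum_range]
  exact integrable_finsetSum _ fun j _ => (integrable_pow_gammaLaw m j).const_mul _

/-- The expectation of a polynomial under the exponential law, as a linear functional. -/
def expFunctional : Polynomial ℝ →ₗ[ℝ] ℝ where
  toFun p := ∫ x, p.eval x ∂gammaLaw 0
  map_add' p q := by
    simp only [Polynomial.eval_add]
    exact integral_add (integrable_eval_gammaLaw 0 p) (integrable_eval_gammaLaw 0 q)
  map_smul' c p := by
    simp only [Polynomial.eval_smul, smul_eq_mul, RingHom.id_apply]
    exact integral_const_mul _ _

lemma expFunctional_apply (p : Polynomial ℝ) :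
    expFunctional p = ∫ x, p.eval x ∂gammaLaw 0 := rfl

lemma expFunctional_X_pow (j : ℕ) : expFunctional (Polynomial.X ^ j) = j.factorial := by
  simp [expFunctional_apply, integral_pow_gammaLaw_zero]

/-- A nonzero polynomial vanishes only on a finite set, which is null for the exponential law, so
its support has positive mass. -/
lemma expFunctional_pos {p : Polynomial ℝ} (hp : p ≠ 0) (h : ∀ x, 0 < x → 0 ≤ p.eval x) :
    0 < expFunctional p := by
  have hnn : 0 ≤ᵐ[gammaLaw 0] fun x => p.eval x :=
    (ae_gammaLaw_pos 0).mono fun x hx => h x hx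
  rw [expFunctional_apply, integral_pos_iff_support_of_nonneg_ae hnn (integrable_eval_gammaLaw 0 p)]
  rw [pos_iff_ne_zero]
  intro h0
  have hfin : (gammaLaw 0) (p.roots.toFinset : Set ℝ) = 0 := by
    refine (withDensity_absolutelyContinuous _ _) ?_
    exact Measure.absolutelyContinuous_of_le Measure.restrict_le_self
      (Finset.measure_zero _ _)
  have huniv : (gammaLaw 0) Set.univ ≤ 0 := by
    calc (gammaLaw 0) Set.univ
        ≤ (gammaLaw 0) (Function.support (fun x => p.eval x) ∪ (p.roots.toFinset : Set ℝ)) := by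
          refine measure_mono fun x _ => ?_
          by_cases hx : p.eval x = 0
          · right; simp [hp, hx]
          · left; exact hx
      _ ≤ 0 := (measure_union_le _ _).trans (by rw [h0, hfin, add_zero])
  simp at huniv

lemma laguerre_coeff (n j : ℕ) :
    (laguerre n).coeff j =
      (-1 : ℝ) ^ j * (n.choose j : ℝ) * (n.factorial : ℝ) / (j.factorial : ℝ) := by
  simp only [laguerre, Polynomial.finsetSum_coeff, Polynomial.coeff_monomial]
  rw [Finset.sum_ite_eq' (Finset.range (n + 1)) j]
  split_ifs with h
  · rfl
  · rw [Nat.choose_eq_zero_of_lt (by simpa using h)]; simp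

lemma laguerre_coeff_self (n : ℕ) : (laguerre n).coeff n = (-1) ^ n := by
  rw [laguerre_coeff]; field_simp; simp

lemma laguerre_ne_zero (n : ℕ) : laguerre n ≠ 0 := fun h => by
  have := laguerre_coeff_self n
  rw [h, Polynomial.coeff_zero] at this
  exact pow_ne_zero n (by norm_num : (-1 : ℝ) ≠ 0) this.symm

lemma natDegree_laguerre (n : ℕ) : (laguerre n).natDegree = n := by
  refine le_antisymm (Polynomial.natDegree_le_iff_coeff_eq_zero.2 fun j hj => ?_)
    (Polynomial.le_natDegree_of_ne_zero (by simp [laguerre_coeff_self]))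
  rw [laguerre_coeff, Nat.choose_eq_zero_of_lt hj]; simp

/-- `x L_n' = n L_n - n² L_{n-1}`. -/
lemma X_mul_derivative_laguerre (n : ℕ) :
    Polynomial.X * (laguerre (n + 1)).derivative =
      Polynomial.C ((n : ℝ) + 1) * laguerre (n + 1) -
        Polynomial.C (((n : ℝ) + 1) ^ 2) * laguerre n := by
  ext j
  rcases j with _ | j
  · rw [Polynomial.coeff_sub, Polynomial.coeff_C_mul, Polynomial.coeff_C_mul, laguerre_coeff,
      laguerre_coeff]
    simp [Nat.factorial_succ]
    ring
  · rw [Polynomial.coeff_X_mul, Polynomial.coeff_derivative, Polynomial.coeff_sub,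
      Polynomial.coeff_C_mul, Polynomial.coeff_C_mul, laguerre_coeff, laguerre_coeff]
    have h1 : ((n + 1).choose (j + 1) : ℝ) * (j + 1) = (n + 1) * n.choose j := by
      exact_mod_cast (Nat.add_one_mul_choose_eq n j).symm
    have h2 : ((n + 1).choose (j + 1) : ℝ) = n.choose j + n.choose (j + 1) := by
      exact_mod_cast Nat.choose_succ_succ n j
    have h3 : ((n + 1).factorial : ℝ) = (n + 1) * n.factorial := by
      exact_mod_cast Nat.factorial_succ n
    rw [h3]
    linear_combination ((-1 : ℝ) ^ (j + 1) * (n + 1) * n.factorial / (j + 1).factorial) *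
      (h1 - (n + 1) * h2)

/-- The moment (j+m)! factors as j! times the rising factorial of j+1, and the j! cancels the one in
the Laguerre coefficient. What remains is an alternating binomial sum of a polynomial of degree m in
j. -/
lemma expFunctional_X_pow_mul_laguerre (n m : ℕ) :
    expFunctional (Polynomial.X ^ m * laguerre n) =
      n.factorial * ∑ j ∈ Finset.range (n + 1),
        (-1 : ℝ) ^ j * n.choose j * (ascPochhammer ℝ m).eval ((j : ℝ) + 1) := by
  have : Polynomial.X ^ m * laguerre n = ∑ j ∈ Finset.range (n + 1),
      ((-1 : ℝ) ^ j * (n.choose j : ℝ) * (n.factorial : ℝ) / (j.factorial : ℝ)) •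
        Polynomial.X ^ (j + m) := by
    rw [laguerre, Finset.mul_sum]
    refine Finset.sum_congr rfl fun j _ => ?_
    rw [← Polynomial.C_mul_X_pow_eq_monomial, Polynomial.smul_eq_C_mul, pow_add]
    ring
  rw [this, map_sum, Finset.mul_sum]
  refine Finset.sum_congr rfl fun j _ => ?_
  rw [map_smul, expFunctional_X_pow, smul_eq_mul]
  have h : ((j + m).factorial : ℝ) = j.factorial * (ascPochhammer ℝ m).eval ((j : ℝ) + 1) := by
    have := Nat.factorial_mul_ascFactorial j m
    rw [← this, Nat.cast_mul, ← ascPochhammer_nat_eq_ascFactorial]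
    congr 1
    rw [← Nat.cast_add_one, ascPochhammer_eval_cast]
  rw [h]
  field_simp

/-- Iterated differences kill polynomials of degree below n and reduce degree n to n! times the
leading coefficient. This is the source of Laguerre orthogonality and of the norm (n!)². -/
lemma alternating_sum_choose_mul_eval (n : ℕ) (p : Polynomial ℝ) :
    ∑ j ∈ Finset.range (n + 1), (-1 : ℝ) ^ j * n.choose j * p.eval ((j : ℝ) + 1) =
      (-1) ^ n * ((fwdDiff (1 : ℝ))^[n] p.eval) 1 := by
  rw [fwdDiff_iter_eq_sum_shift, Finset.mul_sum]
  refine Finset.sum_congr rfl fun j hj => ?_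
  have hj' : j ≤ n := by simpa [Nat.lt_succ_iff] using hj
  obtain ⟨i, rfl⟩ := Nat.exists_eq_add_of_le hj'
  have h1 : ((-1 : ℝ) ^ i) * (-1) ^ i = 1 := by rw [← mul_pow]; norm_num
  rw [Nat.add_sub_cancel_left, nsmul_one, zsmul_eq_mul, pow_add, add_comm (1 : ℝ)]
  push_cast
  linear_combination (-(-1 : ℝ) ^ j * ((j + i).choose j : ℝ) * p.eval ((j : ℝ) + 1)) * h1

lemma expFunctional_mul_laguerre_of_lt {n : ℕ} {q : Polynomial ℝ} (hq : q.natDegree < n) :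
    expFunctional (q * laguerre n) = 0 := by
  have hX : ∀ m < n, expFunctional (Polynomial.X ^ m * laguerre n) = 0 := by
    intro m hm
    rw [expFunctional_X_pow_mul_laguerre, alternating_sum_choose_mul_eval,
      Polynomial.fwdDiff_iter_eq_zero_of_degree_lt (by rwa [ascPochhammer_natDegree])]
    simp
  rw [q.as_sum_range' n hq, Finset.sum_mul, map_sum]
  refine Finset.sum_eq_zero fun j hj => ?_
  rw [← Polynomial.C_mul_X_pow_eq_monomial, mul_assoc, ← Polynomial.smul_eq_C_mul, map_smul,
    hX j (by simpa using hj), smul_zero]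

lemma expFunctional_X_pow_mul_laguerre_self (n : ℕ) :
    expFunctional (Polynomial.X ^ n * laguerre n) = (-1) ^ n * (n.factorial : ℝ) ^ 2 := by
  rw [expFunctional_X_pow_mul_laguerre, alternating_sum_choose_mul_eval]
  have := Polynomial.fwdDiff_iter_degree_eq_factorial (ascPochhammer ℝ n)
  rw [ascPochhammer_natDegree, (monic_ascPochhammer ℝ n).leadingCoeff] at this
  rw [this]
  simp
  ring

lemma expFunctional_mul_laguerre {n : ℕ} {q : Polynomial ℝ} (hq : q.natDegree ≤ n) :
    expFunctional (q * laguerre n) = (-1) ^ n * (n.factorial : ℝ) ^ 2 * q.coeff n := by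
  -- Only the top term contributes: the remainder has degree below n and is orthogonal to L_n. For n
  -- = 0 the remainder is zero, which is treated apart since no degree is below 0.
  have hd : q = (q - Polynomial.C (q.coeff n) * Polynomial.X ^ n) +
      Polynomial.C (q.coeff n) * Polynomial.X ^ n := by ring
  have h0 : expFunctional ((q - Polynomial.C (q.coeff n) * Polynomial.X ^ n) * laguerre n) = 0 := by
    rcases Nat.eq_zero_or_pos n with rfl | hn
    · rw [Polynomial.eq_C_of_natDegree_le_zero hq]; simp
    · refine expFunctional_mul_laguerre_of_lt ?_
      refine lt_of_le_of_lt (Polynomial.natDegree_le_iff_coeff_eq_zero.2 fun j hj => ?_)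
        (Nat.sub_lt hn one_pos)
      rw [Polynomial.coeff_sub, Polynomial.coeff_C_mul_X_pow]
      split_ifs with h
      · simp [h]
      · rw [Polynomial.coeff_eq_zero_of_natDegree_lt (by omega), sub_zero]
  conv_lhs => rw [hd, add_mul, map_add, h0, zero_add, mul_assoc, ← Polynomial.smul_eq_C_mul,
    map_smul, expFunctional_X_pow_mul_laguerre_self, smul_eq_mul]
  ring


/-! ### The Gauss-Laguerre rule -/

/-- The set s collects the positive roots of odd multiplicity. Stripping one factor X - r from p
toggles the membership of r in s: either the product is unchanged or it gains the square (X - r)².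
Without positive roots the intermediate value theorem fixes the sign. -/
lemma exists_simple_factor_constant_sign (p : Polynomial ℝ) (hp : p ≠ 0) :
    ∃ s : Finset ℝ, (∀ r ∈ s, 0 < r ∧ p.IsRoot r) ∧
      ((∀ x, 0 < x → 0 ≤ (p * ∏ r ∈ s, (Polynomial.X - Polynomial.C r)).eval x) ∨
        (∀ x, 0 < x → (p * ∏ r ∈ s, (Polynomial.X - Polynomial.C r)).eval x ≤ 0)) := by
  induction hn : p.natDegree using Nat.strong_induction_on generalizing p with
  | _ n ih =>
    by_cases hroot : ∃ r, 0 < r ∧ p.IsRoot r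
    · obtain ⟨r, hr, hpr⟩ := hroot
      obtain ⟨q, rfl⟩ := Polynomial.dvd_iff_isRoot.2 hpr
      have hq : q ≠ 0 := right_ne_zero_of_mul hp
      have hdeg : q.natDegree < n := by
        rw [← hn, Polynomial.natDegree_mul (Polynomial.X_sub_C_ne_zero r) hq,
          Polynomial.natDegree_X_sub_C]
        omega
      obtain ⟨s, hs, hsign⟩ := ih _ hdeg q hq rfl
      have hs' : ∀ t ∈ s, 0 < t ∧ ((Polynomial.X - Polynomial.C r) * q).IsRoot t := fun t ht =>
        ⟨(hs t ht).1, by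
          have := (hs t ht).2
          rw [Polynomial.IsRoot.def] at this ⊢
          simp [this]⟩
      by_cases hrs : r ∈ s
      · refine ⟨s.erase r, fun t ht => hs' t (Finset.mem_of_mem_erase ht), ?_⟩
        have : (Polynomial.X - Polynomial.C r) * q *
            ∏ t ∈ s.erase r, (Polynomial.X - Polynomial.C t) =
            q * ∏ t ∈ s, (Polynomial.X - Polynomial.C t) := by
          rw [← Finset.mul_prod_erase s _ hrs]; ring
        rwa [this]
      · refine ⟨insert r s, ?_, ?_⟩
        · intro t ht
          rcases Finset.mem_insert.1 ht with rfl | ht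
          · exact ⟨hr, hpr⟩
          · exact hs' t ht
        · have : ∀ x, ((Polynomial.X - Polynomial.C r) * q *
              ∏ t ∈ insert r s, (Polynomial.X - Polynomial.C t)).eval x =
              (x - r) ^ 2 * (q * ∏ t ∈ s, (Polynomial.X - Polynomial.C t)).eval x := by
            intro x
            rw [Finset.prod_insert hrs]
            simp only [Polynomial.eval_mul, Polynomial.eval_sub, Polynomial.eval_X,
              Polynomial.eval_C]
            ring
          simp only [this]
          exact hsign.imp (fun h x hx => mul_nonneg (sq_nonneg _) (h x hx))
            (fun h x hx => mul_nonpos_of_nonneg_of_nonpos (sq_nonneg _) (h x hx))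
    · refine ⟨∅, by simp, ?_⟩
      push Not at hroot
      simp only [Finset.prod_empty, mul_one]
      by_contra! hcon
      obtain ⟨⟨x, hx, hpx⟩, y, hy, hpy⟩ := hcon
      have hsub : Set.uIcc x y ⊆ Set.Ioi 0 := fun z hz =>
        lt_of_lt_of_le (lt_min hx hy) hz.1
      obtain ⟨z, hz, hz0⟩ := intermediate_value_uIcc (a := x) (b := y) (f := fun z => p.eval z)
        p.continuous.continuousOn (Set.mem_uIcc.2 (Or.inl ⟨hpx.le, hpy.le⟩))
      exact hroot z (hsub hz) hz0

/-- With fewer than n sign changes on the positive axis, L_n times the matching product of linear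
factors would have constant sign, hence nonzero expectation, against orthogonality. The n sign
changes exhaust the degree. -/
lemma card_laguerreNodes_and_pos (n : ℕ) :
    (laguerreNodes n).card = n ∧ ∀ τ ∈ laguerreNodes n, 0 < τ := by
  obtain ⟨s, hs, hsign⟩ := exists_simple_factor_constant_sign (laguerre n) (laguerre_ne_zero n)
  set q : Polynomial ℝ := ∏ r ∈ s, (Polynomial.X - Polynomial.C r) with hq
  have hqm : q.Monic := Polynomial.monic_prod_of_monic _ _ fun r _ => Polynomial.monic_X_sub_C r
  have hqd : q.natDegree = s.card := by
    rw [hq, Polynomial.natDegree_prod_of_monic _ _ fun r _ => Polynomial.monic_X_sub_C r]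
    simp
  have hne : laguerre n * q ≠ 0 := mul_ne_zero (laguerre_ne_zero n) hqm.ne_zero
  have hcard : n ≤ s.card := by
    by_contra! hlt
    have h0 : expFunctional (laguerre n * q) = 0 := by
      rw [mul_comm]
      exact expFunctional_mul_laguerre_of_lt (by rwa [hqd])
    rcases hsign with h | h
    · exact (expFunctional_pos hne h).ne' h0
    · have := expFunctional_pos (neg_ne_zero.2 hne) (fun x hx => by
        rw [Polynomial.eval_neg]; exact neg_nonneg.2 (h x hx))
      rw [map_neg, h0] at this
      simp at this
  have hsub : s ⊆ laguerreNodes n := fun r hr => by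
    simpa [laguerreNodes, laguerre_ne_zero] using (hs r hr).2
  have hle : (laguerreNodes n).card ≤ n := by
    calc _ ≤ Multiset.card (laguerre n).roots := Multiset.toFinset_card_le _
      _ ≤ (laguerre n).natDegree := Polynomial.card_roots' _
      _ = n := natDegree_laguerre n
  have hcs := Finset.card_le_card hsub
  have heq : s = laguerreNodes n := Finset.eq_of_subset_of_card_le hsub (by omega)
  exact ⟨by omega, fun τ hτ => (hs τ (heq ▸ hτ)).1⟩

lemma card_laguerreNodes (n : ℕ) : (laguerreNodes n).card = n := (card_laguerreNodes_and_pos n).1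

lemma laguerreNodes_pos {n : ℕ} {τ : ℝ} (h : τ ∈ laguerreNodes n) : 0 < τ :=
  (card_laguerreNodes_and_pos n).2 τ h

lemma eval_laguerre_of_mem {n : ℕ} {τ : ℝ} (h : τ ∈ laguerreNodes n) :
    (laguerre n).eval τ = 0 := by
  simpa [laguerreNodes, laguerre_ne_zero] using h

/-- Divide p by L_n. The quotient has degree below n, so its product with L_n has zero expectation;
the remainder agrees with p at the nodes and equals its own Lagrange interpolant. -/
lemma expFunctional_eq_sum_basis {n : ℕ} {p : Polynomial ℝ} (hp : p.natDegree < 2 * n) :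
    expFunctional p = ∑ τ ∈ laguerreNodes n,
      p.eval τ * expFunctional (Lagrange.basis (laguerreNodes n) id τ) := by
  have hdm := EuclideanDomain.div_add_mod p (laguerre n)
  have hdeg : (p % laguerre n).degree < n := by
    have h1 := Polynomial.degree_mod_lt p (laguerre_ne_zero n)
    rwa [Polynomial.degree_eq_natDegree (laguerre_ne_zero n), natDegree_laguerre] at h1
  have hquot : (p / laguerre n).natDegree < n := by
    by_cases h0 : p / laguerre n = 0
    · rw [h0, Polynomial.natDegree_zero]
      omega
    · have h1 : (laguerre n * (p / laguerre n)).natDegree = n + (p / laguerre n).natDegree := by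
        rw [Polynomial.natDegree_mul (laguerre_ne_zero n) h0, natDegree_laguerre]
      have h2 : (p % laguerre n).natDegree < 2 * n :=
        (Polynomial.natDegree_mod_lt p (by rw [natDegree_laguerre]; omega)).trans
          (by rw [natDegree_laguerre]; omega)
      have h3 := Polynomial.natDegree_sub_le p (p % laguerre n)
      rw [← eq_sub_iff_add_eq.2 hdm, h1] at h3
      omega
  have hr : expFunctional p = expFunctional (p % laguerre n) := by
    conv_lhs => rw [← hdm, map_add, mul_comm, expFunctional_mul_laguerre_of_lt hquot, zero_add]
  rw [hr, Lagrange.eq_interpolate (f := p % laguerre n) (s := laguerreNodes n) (v := id)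
      (Set.injOn_id _) (by rwa [card_laguerreNodes]),
    Lagrange.interpolate_apply, map_sum]
  refine Finset.sum_congr rfl fun τ hτ => ?_
  rw [← Polynomial.smul_eq_C_mul, map_smul, smul_eq_mul]
  congr 1
  conv_rhs => rw [← hdm]
  simp [eval_laguerre_of_mem hτ]

lemma laguerre_eq_prod (n : ℕ) :
    laguerre n = Polynomial.C ((-1) ^ n) *
      ∏ r ∈ laguerreNodes n, (Polynomial.X - Polynomial.C r) := by
  have hcard : Multiset.card (laguerre n).roots = (laguerre n).natDegree := by
    refine le_antisymm (Polynomial.card_roots' _) ?_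
    rw [natDegree_laguerre]
    conv_lhs => rw [← card_laguerreNodes n]
    exact Multiset.toFinset_card_le _
  have hnodup : (laguerre n).roots.Nodup := by
    rw [← Multiset.toFinset_card_eq_card_iff_nodup, hcard, natDegree_laguerre]
    exact card_laguerreNodes n
  conv_lhs => rw [← Polynomial.C_leadingCoeff_mul_prod_multiset_X_sub_C hcard]
  rw [Polynomial.leadingCoeff, natDegree_laguerre, laguerre_coeff_self, laguerreNodes,
    Finset.prod, Multiset.toFinset_val, hnodup.dedup]

/-- Apply exactness to q L_n with q = L_{n+1}/(X - τ). Only the node τ survives, with q(τ) =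
L_{n+1}'(τ), while orthogonality evaluates the expectation from the top coefficient (-1)^(n+1) of q.
-/
lemma expFunctional_basis_mul {n : ℕ} {τ : ℝ} (hτ : τ ∈ laguerreNodes (n + 1)) :
    expFunctional (Lagrange.basis (laguerreNodes (n + 1)) id τ) *
      ((laguerre (n + 1)).derivative.eval τ * (laguerre n).eval τ) = -(n.factorial : ℝ) ^ 2 := by
  set q : Polynomial ℝ := Polynomial.C ((-1) ^ (n + 1)) *
    ∏ r ∈ (laguerreNodes (n + 1)).erase τ, (Polynomial.X - Polynomial.C r) with hq
  have hL : laguerre (n + 1) = (Polynomial.X - Polynomial.C τ) * q := by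
    rw [laguerre_eq_prod (n + 1), ← Finset.mul_prod_erase _ _ hτ, hq]
    ring
  have hm : (∏ r ∈ (laguerreNodes (n + 1)).erase τ,
      (Polynomial.X - Polynomial.C r)).Monic :=
    Polynomial.monic_prod_of_monic _ _ fun r _ => Polynomial.monic_X_sub_C r
  have hmd : (∏ r ∈ (laguerreNodes (n + 1)).erase τ,
      (Polynomial.X - Polynomial.C r)).natDegree = n := by
    rw [Polynomial.natDegree_prod_of_monic _ _ fun r _ => Polynomial.monic_X_sub_C r]
    simp [Finset.card_erase_of_mem hτ, card_laguerreNodes]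
  have hqd : q.natDegree ≤ n := (Polynomial.natDegree_C_mul_le _ _).trans hmd.le
  have hqc : q.coeff n = (-1) ^ (n + 1) := by
    have := hm.coeff_natDegree
    rw [hmd] at this
    rw [hq, Polynomial.coeff_C_mul, this, mul_one]
  have h1 : expFunctional (q * laguerre n) = -(n.factorial : ℝ) ^ 2 := by
    rw [expFunctional_mul_laguerre hqd, hqc]
    have : ((-1 : ℝ) ^ n) * (-1) ^ n = 1 := by rw [← mul_pow]; norm_num
    rw [pow_succ (-1 : ℝ) n]
    linear_combination -(n.factorial : ℝ) ^ 2 * this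
  have hdeg : (q * laguerre n).natDegree < 2 * (n + 1) := by
    have := Polynomial.natDegree_mul_le (p := q) (q := laguerre n)
    rw [natDegree_laguerre] at this
    omega
  rw [expFunctional_eq_sum_basis hdeg, Finset.sum_eq_single_of_mem τ hτ] at h1
  · rw [← h1, Polynomial.eval_mul]
    have : (laguerre (n + 1)).derivative.eval τ = q.eval τ := by
      rw [hL, Polynomial.derivative_mul]
      simp
    rw [this]
    ring
  · intro σ hσ hne
    have := eval_laguerre_of_mem hσ
    rw [hL, Polynomial.eval_mul] at this
    have hq0 : q.eval σ = 0 := by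
      refine (mul_eq_zero.1 this).resolve_left ?_
      simpa [sub_eq_zero] using hne
    rw [Polynomial.eval_mul, hq0]
    ring

/-- At a zero of L_{n+1} the derivative recurrence reads τ L_{n+1}' = -(n+1)² L_n, which trades the
factor L_n for a second factor L_{n+1}' and leaves a square in the denominator. -/
lemma expFunctional_basis_eq_weight {n : ℕ} {τ : ℝ} (hτ : τ ∈ laguerreNodes n) :
    expFunctional (Lagrange.basis (laguerreNodes n) id τ) = laguerreWeight n τ ∧
      0 < laguerreWeight n τ := by
  rcases n with _ | n
  · have := card_laguerreNodes 0
    rw [Finset.card_eq_zero] at this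
    simp [this] at hτ
  have h1 := expFunctional_basis_mul hτ
  have h2 := congrArg (Polynomial.eval τ) (X_mul_derivative_laguerre n)
  simp only [Polynomial.eval_mul, Polynomial.eval_X, Polynomial.eval_sub, Polynomial.eval_C,
    eval_laguerre_of_mem hτ, mul_zero, zero_sub] at h2
  have hpos := laguerreNodes_pos hτ
  -- A vanishing derivative would make the product in `h1` zero instead of -(n!)².
  have hd : (laguerre (n + 1)).derivative.eval τ ≠ 0 := by
    intro h0
    rw [h0] at h1
    have : (n.factorial : ℝ) ^ 2 ≠ 0 := by positivity
    simp at h1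
    exact this (by simp [h1])
  have hfac : ((n + 1).factorial : ℝ) = (n + 1) * n.factorial := by
    exact_mod_cast Nat.factorial_succ n
  constructor
  · rw [laguerreWeight, eq_div_iff (by positivity), hfac]
    linear_combination expFunctional (Lagrange.basis (laguerreNodes (n + 1)) id τ) *
      (laguerre (n + 1)).derivative.eval τ * h2 - ((n : ℝ) + 1) ^ 2 * h1
  · rw [laguerreWeight]
    positivity

lemma laguerreWeight_pos {n : ℕ} {τ : ℝ} (hτ : τ ∈ laguerreNodes n) : 0 < laguerreWeight n τ :=
  (expFunctional_basis_eq_weight hτ).2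

/-- The Gauss-Laguerre rule with `n` nodes is exact for polynomials of degree less than `2n`. -/
theorem sum_laguerreWeight_mul_eval {n : ℕ} {p : Polynomial ℝ} (hp : p.natDegree < 2 * n) :
    ∑ τ ∈ laguerreNodes n, laguerreWeight n τ * p.eval τ = expFunctional p := by
  rw [expFunctional_eq_sum_basis hp]
  refine Finset.sum_congr rfl fun τ hτ => ?_
  rw [(expFunctional_basis_eq_weight hτ).1, mul_comm]

lemma sum_laguerreWeight_mul_pow {n j : ℕ} (h : j < 2 * n) :
    ∑ τ ∈ laguerreNodes n, laguerreWeight n τ * τ ^ j = j.factorial := by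
  simpa [expFunctional_X_pow] using
    sum_laguerreWeight_mul_eval (n := n) (p := Polynomial.X ^ j) (by simpa using h)

lemma sum_laguerreWeight {n : ℕ} (h : 1 ≤ n) :
    ∑ τ ∈ laguerreNodes n, laguerreWeight n τ = 1 := by
  simpa using sum_laguerreWeight_mul_pow (n := n) (j := 0) (by omega)


/-! ### Convergence of moments and weak convergence -/

/-- The derivative in s of the remainder of order m+1 is iθ times the remainder of order m, and the
bounds satisfy the matching relation. The mean value inequality from s = 0 closes the induction. -/
lemma norm_exp_ofReal_mul_I_sub_taylor_le (θ : ℝ) (m : ℕ) {s : ℝ} (hs : 0 ≤ s) :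
    ‖Complex.exp ((θ * s : ℝ) * Complex.I) -
      ∑ i ∈ Finset.range m, ((θ * s : ℝ) * Complex.I) ^ i / (i.factorial : ℂ)‖ ≤
      (|θ| * s) ^ m / m.factorial := by
  induction m generalizing s with
  | zero => simpa using (Complex.norm_exp_ofReal_mul_I (θ * s)).le
  | succ m ih =>
    have hlin : ∀ x : ℝ, HasDerivAt (fun x : ℝ => ((θ * x : ℝ) * Complex.I)) (θ * Complex.I) x := by
      intro x
      have h := ((hasDerivAt_id x).const_mul θ).ofReal_comp.mul_const Complex.I
      simpa using h
    have hsum : ∀ x : ℝ, HasDerivAt (fun x : ℝ => ∑ i ∈ Finset.range (m + 1),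
        ((θ * x : ℝ) * Complex.I) ^ i / (i.factorial : ℂ))
        (θ * Complex.I * ∑ i ∈ Finset.range m, ((θ * x : ℝ) * Complex.I) ^ i / (i.factorial : ℂ))
        x := by
      intro x
      have h : ∀ i ∈ Finset.range (m + 1), HasDerivAt (fun x : ℝ =>
          ((θ * x : ℝ) * Complex.I) ^ i / (i.factorial : ℂ))
          ((i : ℂ) * ((θ * x : ℝ) * Complex.I) ^ (i - 1) * (θ * Complex.I) / (i.factorial : ℂ)) x :=
        fun i _ => ((hlin x).pow i).div_const _
      refine (HasDerivAt.fun_sum h).congr_deriv ?_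
      rw [Finset.sum_range_succ', Finset.mul_sum]
      simp only [Nat.cast_zero, zero_mul, zero_div, add_zero]
      refine Finset.sum_congr rfl fun i _ => ?_
      have hi : ((i : ℂ) + 1) ≠ 0 := Nat.cast_add_one_ne_zero i
      have hf : (i.factorial : ℂ) ≠ 0 := by exact_mod_cast i.factorial_ne_zero
      rw [Nat.factorial_succ, Nat.add_sub_cancel]
      push_cast
      field_simp
    have hf : ∀ x : ℝ, HasDerivAt (fun x : ℝ => Complex.exp ((θ * x : ℝ) * Complex.I) -
        ∑ i ∈ Finset.range (m + 1), ((θ * x : ℝ) * Complex.I) ^ i / (i.factorial : ℂ))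
        (θ * Complex.I * (Complex.exp ((θ * x : ℝ) * Complex.I) -
          ∑ i ∈ Finset.range m, ((θ * x : ℝ) * Complex.I) ^ i / (i.factorial : ℂ))) x := by
      intro x
      refine ((hlin x).cexp.sub (hsum x)).congr_deriv ?_
      ring
    have hB : ∀ x : ℝ, HasDerivAt (fun x : ℝ => (|θ| * x) ^ (m + 1) / (m + 1).factorial)
        (|θ| * ((|θ| * x) ^ m / m.factorial)) x := by
      intro x
      refine ((((hasDerivAt_id x).const_mul |θ|).pow (m + 1)).div_const _).congr_deriv ?_
      rw [Nat.factorial_succ]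
      push_cast
      simp only [id]
      field_simp
    refine image_norm_le_of_norm_deriv_right_le_deriv_boundary (a := 0) (b := s)
      (fun x _ => (hf x).continuousAt.continuousWithinAt) (fun x _ => (hf x).hasDerivWithinAt)
      ?_ hB (fun x hx => ?_) (Set.right_mem_Icc.2 hs)
    · simp [Finset.sum_range_succ']
    · rw [norm_mul, norm_mul, Complex.norm_I, mul_one, Complex.norm_real, Real.norm_eq_abs]
      exact mul_le_mul_of_nonneg_left (ih hx.1) (abs_nonneg θ)

/-- The moment of order `j` twisted by the character of frequency `t`. -/
def twistedMoment (μ : Measure ℝ) (j : ℕ) (t : ℝ) : ℂ :=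
  ∫ x, (x : ℂ) ^ j * Complex.exp ((t * x : ℝ) * Complex.I) ∂μ

lemma integrable_twistedMoment {μ : Measure ℝ} {j : ℕ} (h : Integrable (fun x : ℝ => x ^ j) μ)
    (t : ℝ) : Integrable (fun x : ℝ => (x : ℂ) ^ j * Complex.exp ((t * x : ℝ) * Complex.I)) μ := by
  refine h.norm.mono' (by fun_prop) (ae_of_all _ fun x => ?_)
  rw [norm_mul, Complex.norm_exp_ofReal_mul_I, mul_one, ← Complex.ofReal_pow, Complex.norm_real]

/-- Expanding exp(isx) under the integral produces twisted moments of higher order at the same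
frequency t. The remainder depends on μ only through the plain moment of order j+m, so it is uniform
along a sequence with convergent moments. -/
lemma norm_twistedMoment_add_sub_le {μ : Measure ℝ} (h0 : ∀ᵐ x ∂μ, 0 ≤ x)
    (hint : ∀ j : ℕ, Integrable (fun x : ℝ => x ^ j) μ) (j m : ℕ) (t s : ℝ) :
    ‖twistedMoment μ j (t + s) - ∑ i ∈ Finset.range m,
      (s * Complex.I) ^ i / (i.factorial : ℂ) * twistedMoment μ (j + i) t‖ ≤
      |s| ^ m / m.factorial * ∫ x, x ^ (j + m) ∂μ := by
  have h1 : twistedMoment μ j (t + s) - ∑ i ∈ Finset.range m,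
      (s * Complex.I) ^ i / (i.factorial : ℂ) * twistedMoment μ (j + i) t =
      ∫ x, (x : ℂ) ^ j * Complex.exp ((t * x : ℝ) * Complex.I) *
        (Complex.exp ((s * x : ℝ) * Complex.I) -
          ∑ i ∈ Finset.range m, ((s * x : ℝ) * Complex.I) ^ i / (i.factorial : ℂ)) ∂μ := by
    simp only [twistedMoment, ← integral_const_mul]
    rw [← integral_finsetSum _ fun i _ => (integrable_twistedMoment (hint (j + i)) t).const_mul _,
      ← integral_sub (integrable_twistedMoment (hint j) (t + s))
        (integrable_finsetSum _ fun i _ =>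
          (integrable_twistedMoment (hint (j + i)) t).const_mul _)]
    refine integral_congr_ae (ae_of_all _ fun x => ?_)
    simp only
    rw [add_mul t s x, Complex.ofReal_add, add_mul, Complex.exp_add, mul_sub, Finset.mul_sum]
    congr 1
    · ring
    · refine Finset.sum_congr rfl fun i _ => ?_
      push_cast
      ring
  rw [h1, ← integral_const_mul]
  refine norm_integral_le_of_norm_le ((hint (j + m)).const_mul _) ?_
  filter_upwards [h0] with x hx
  rw [norm_mul, norm_mul, Complex.norm_exp_ofReal_mul_I, mul_one, ← Complex.ofReal_pow,
    Complex.norm_real, Real.norm_of_nonneg (pow_nonneg hx j)]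
  refine (mul_le_mul_of_nonneg_left (norm_exp_ofReal_mul_I_sub_taylor_le s m hx)
    (pow_nonneg hx j)).trans_eq ?_
  rw [mul_pow, pow_add]
  ring

/-- The ratio (j+m)!/m! is at most (j+m)^j, of polynomial growth in m, so any ratio below 1 would
serve; 1/2 is the step length used for the frequency. -/
lemma tendsto_half_pow_mul_factorial_div (j : ℕ) :
    Tendsto (fun m : ℕ => (1 / 2 : ℝ) ^ m / m.factorial * (j + m).factorial) atTop (𝓝 0) := by
  have h1 : Tendsto (fun m : ℕ => (((j + m : ℕ) : ℝ) ^ j * (1 / 2 : ℝ) ^ (j + m)) * 2 ^ j) atTop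
      (𝓝 0) := by
    have h := tendsto_pow_const_mul_const_pow_of_abs_lt_one j (r := (1 / 2 : ℝ))
      (by norm_num [abs_of_pos])
    have h' := (h.comp (tendsto_add_atTop_nat j)).mul_const ((2 : ℝ) ^ j)
    simpa [Function.comp_def, add_comm] using h'
  refine squeeze_zero (fun m => by positivity) (fun m => ?_) h1
  have h2 : ((j + m).factorial : ℝ) ≤ m.factorial * ((j + m : ℕ) : ℝ) ^ j := by
    have h3 := Nat.factorial_mul_descFactorial (Nat.le_add_right j m)
    have h4 := Nat.descFactorial_le_pow (j + m) j
    rw [Nat.add_sub_cancel_left] at h3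
    rw [← h3]
    push_cast
    exact mul_le_mul_of_nonneg_left (by exact_mod_cast h4) (by positivity)
  have h5 : (1 / 2 : ℝ) ^ (j + m) * 2 ^ j = (1 / 2) ^ m := by
    rw [pow_add, mul_right_comm, ← mul_pow]; norm_num
  rw [mul_assoc, h5, div_mul_eq_mul_div, div_le_iff₀ (by positivity)]
  calc (1 / 2 : ℝ) ^ m * (j + m).factorial
      ≤ (1 / 2 : ℝ) ^ m * (m.factorial * ((j + m : ℕ) : ℝ) ^ j) := by gcongr
    _ = _ := by ring

section Moments

variable {μ : ℕ → Measure ℝ} {ν : Measure ℝ}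

/-- Convergence is assumed for every order at t because the Taylor terms of order j at t+s involve
the orders j+i at t. -/
lemma tendsto_twistedMoment_add (hμ0 : ∀ n, ∀ᵐ x ∂μ n, 0 ≤ x) (hν0 : ∀ᵐ x ∂ν, 0 ≤ x)
    (hμ : ∀ n j, Integrable (fun x : ℝ => x ^ j) (μ n))
    (hν : ∀ j, Integrable (fun x : ℝ => x ^ j) ν)
    (hbound : ∀ j, ∫ x, x ^ j ∂ν ≤ j.factorial)
    (hmom : ∀ j : ℕ, Tendsto (fun n => ∫ x, x ^ j ∂μ n) atTop (𝓝 (∫ x, x ^ j ∂ν)))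
    {t s : ℝ} (hs : |s| ≤ 1 / 2)
    (ht : ∀ j, Tendsto (fun n => twistedMoment (μ n) j t) atTop (𝓝 (twistedMoment ν j t)))
    (j : ℕ) :
    Tendsto (fun n => twistedMoment (μ n) j (t + s)) atTop (𝓝 (twistedMoment ν j (t + s))) := by
  rw [Metric.tendsto_nhds]
  intro ε hε
  -- This m is fixed before n. The two remainders and the difference of the Taylor sums then cost
  -- ε/4 each.
  obtain ⟨m, hm⟩ := ((tendsto_half_pow_mul_factorial_div j).eventually
    (gt_mem_nhds (show (0 : ℝ) < ε / 4 by positivity))).exists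
  have hδ : |s| ^ m / m.factorial * ∫ x, x ^ (j + m) ∂ν < ε / 4 := by
    refine lt_of_le_of_lt ?_ hm
    calc |s| ^ m / m.factorial * ∫ x, x ^ (j + m) ∂ν
        ≤ |s| ^ m / m.factorial * (j + m).factorial :=
          mul_le_mul_of_nonneg_left (hbound _) (by positivity)
      _ ≤ _ := by gcongr
  have hA : Tendsto (fun n => ∑ i ∈ Finset.range m,
      (s * Complex.I) ^ i / (i.factorial : ℂ) * twistedMoment (μ n) (j + i) t) atTop
      (𝓝 (∑ i ∈ Finset.range m,
        (s * Complex.I) ^ i / (i.factorial : ℂ) * twistedMoment ν (j + i) t)) :=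
    tendsto_finsetSum _ fun i _ => (ht (j + i)).const_mul _
  filter_upwards [((hmom (j + m)).const_mul (|s| ^ m / m.factorial)).eventually (gt_mem_nhds hδ),
    (Metric.tendsto_nhds.1 hA) (ε / 4) (by positivity)] with n h1 h2
  have e1 := norm_twistedMoment_add_sub_le (hμ0 n) (hμ n) j m t s
  have e2 := norm_twistedMoment_add_sub_le hν0 hν j m t s
  rw [← dist_eq_norm] at e1 e2
  have e3 := dist_triangle4 (twistedMoment (μ n) j (t + s)) (∑ i ∈ Finset.range m,
      (s * Complex.I) ^ i / (i.factorial : ℂ) * twistedMoment (μ n) (j + i) t)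
      (∑ i ∈ Finset.range m, (s * Complex.I) ^ i / (i.factorial : ℂ) * twistedMoment ν (j + i) t)
      (twistedMoment ν j (t + s))
  rw [dist_comm (twistedMoment ν j (t + s))] at e2
  linarith

lemma tendsto_twistedMoment (hμ0 : ∀ n, ∀ᵐ x ∂μ n, 0 ≤ x) (hν0 : ∀ᵐ x ∂ν, 0 ≤ x)
    (hμ : ∀ n j, Integrable (fun x : ℝ => x ^ j) (μ n))
    (hν : ∀ j, Integrable (fun x : ℝ => x ^ j) ν)
    (hbound : ∀ j, ∫ x, x ^ j ∂ν ≤ j.factorial)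
    (hmom : ∀ j : ℕ, Tendsto (fun n => ∫ x, x ^ j ∂μ n) atTop (𝓝 (∫ x, x ^ j ∂ν)))
    (t : ℝ) (j : ℕ) :
    Tendsto (fun n => twistedMoment (μ n) j t) atTop (𝓝 (twistedMoment ν j t)) := by
  obtain ⟨k, hk⟩ := exists_nat_ge (2 * |t|)
  induction k generalizing t j with
  | zero =>
    have h0 : t = 0 := by
      have := abs_nonneg t
      have : |t| = 0 := by push_cast at hk; linarith
      simpa using this
    subst h0
    have h (ξ : Measure ℝ) : twistedMoment ξ j 0 = ((∫ x, x ^ j ∂ξ : ℝ) : ℂ) := by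
      rw [twistedMoment, ← integral_complex_ofReal]
      simp
    simp only [h]
    exact (Complex.continuous_ofReal.tendsto _).comp (hmom j)
  | succ k ih =>
    have hk1 : (0 : ℝ) < k + 1 := by positivity
    -- Reach t from 0 in k+1 equal steps of length at most 1/2; the induction covers the first k of
    -- them.
    have e : t = t * k / (k + 1) + t / (k + 1) := by field_simp
    rw [e]
    have hk' : 2 * |t| ≤ k + 1 := by exact_mod_cast hk
    refine tendsto_twistedMoment_add hμ0 hν0 hμ hν hbound hmom ?_ (fun i => ih _ i ?_) j
    · rw [abs_div, abs_of_pos hk1, div_le_iff₀ hk1]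
      linarith
    · rw [abs_div, abs_mul, abs_of_pos hk1, Nat.abs_cast, ← mul_div_assoc, div_le_iff₀ hk1]
      nlinarith [Nat.cast_nonneg (α := ℝ) k]

end Moments

/-! ### The Gauss-Laguerre rule as a measure -/

/-- The discrete measure of the Gauss-Laguerre rule with `n` nodes. -/
def gaussLaguerre (n : ℕ) : Measure ℝ :=
  ∑ τ ∈ laguerreNodes n, ENNReal.ofReal (laguerreWeight n τ) • Measure.dirac τ

lemma integrable_gaussLaguerre (n : ℕ) (f : ℝ → ℝ) : Integrable f (gaussLaguerre n) := by
  rw [gaussLaguerre, integrable_finsetSum_measure]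
  exact fun τ _ => (integrable_dirac (by simp)).smul_measure ENNReal.ofReal_ne_top

lemma integral_gaussLaguerre (n : ℕ) (f : ℝ → ℝ) :
    ∫ x, f x ∂gaussLaguerre n = ∑ τ ∈ laguerreNodes n, laguerreWeight n τ * f τ := by
  rw [gaussLaguerre, integral_finsetSum_measure]
  · refine Finset.sum_congr rfl fun τ hτ => ?_
    rw [integral_smul_measure, integral_dirac, ENNReal.toReal_ofReal (laguerreWeight_pos hτ).le,
      smul_eq_mul]
  · exact fun τ _ => (integrable_dirac (by simp)).smul_measure ENNReal.ofReal_ne_top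

lemma isProbabilityMeasure_gaussLaguerre (n : ℕ) :
    IsProbabilityMeasure (gaussLaguerre (n + 1)) := by
  constructor
  simp only [gaussLaguerre, Measure.finsetSum_apply, Measure.smul_apply, measure_univ,
    smul_eq_mul, mul_one]
  rw [← ENNReal.ofReal_sum_of_nonneg fun τ hτ => (laguerreWeight_pos hτ).le,
    sum_laguerreWeight (by omega), ENNReal.ofReal_one]

lemma ae_gaussLaguerre_nonneg (n : ℕ) : ∀ᵐ x ∂gaussLaguerre n, 0 ≤ x := by
  rw [ae_iff, gaussLaguerre, Measure.finsetSum_apply]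
  refine Finset.sum_eq_zero fun τ hτ => ?_
  have : (0 : ℝ) ≤ τ := (laguerreNodes_pos hτ).le
  simp [this]

/-- The Gauss-Laguerre rules as probability measures, from one node on. -/
def gaussLaguerreProb (n : ℕ) : ProbabilityMeasure ℝ :=
  ⟨gaussLaguerre (n - 1 + 1), isProbabilityMeasure_gaussLaguerre _⟩

/-- The exponential law as a probability measure. -/
def expProb : ProbabilityMeasure ℝ := ⟨gammaLaw 0, inferInstance⟩

/-- Exactness makes each fixed moment eventually constant and equal to j!. The twisted moment of
order 0 is the characteristic function, so Lévy's continuity theorem applies. -/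
theorem tendsto_gaussLaguerreProb : Tendsto gaussLaguerreProb atTop (𝓝 expProb) := by
  refine ProbabilityMeasure.tendsto_iff_tendsto_charFun.2 fun t => ?_
  have h := tendsto_twistedMoment (μ := fun n => gaussLaguerre (n - 1 + 1)) (ν := gammaLaw 0)
    (fun n => ae_gaussLaguerre_nonneg _) ((ae_gammaLaw_pos 0).mono fun _ h => h.le)
    (fun n j => integrable_gaussLaguerre _ _) (integrable_pow_gammaLaw 0)
    (fun j => (integral_pow_gammaLaw_zero j).le) (fun j => ?_) t 0
  · have hc (ξ : Measure ℝ) : charFun ξ t = twistedMoment ξ 0 t := by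
      simp [charFun_apply_real, twistedMoment]
    simp only [hc]
    exact h
  · rw [integral_pow_gammaLaw_zero]
    refine tendsto_const_nhds.congr' ?_
    filter_upwards [eventually_ge_atTop (j + 1)] with n hn
    rw [integral_gaussLaguerre, sum_laguerreWeight_mul_pow (by omega)]

/-- Convergence of the iterated Gauss-Laguerre rules for bounded continuous functions. -/
theorem tendsto_sum_laguerreWeight_sum_laguerreWeight
    (f : BoundedContinuousFunction (ℝ × ℝ) ℝ) :
    Tendsto (fun n : ℕ × ℕ => ∑ σ ∈ laguerreNodes n.1, ∑ τ ∈ laguerreNodes n.2,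
        laguerreWeight n.1 σ * laguerreWeight n.2 τ * f (σ, τ)) atTop
      (𝓝 (∫ x, f x ∂(gammaLaw 0).prod (gammaLaw 0))) := by
  have h1 : Tendsto (fun n : ℕ × ℕ => (gaussLaguerreProb n.1).prod (gaussLaguerreProb n.2)) atTop
      (𝓝 (expProb.prod expProb)) := by
    rw [← prod_atTop_atTop_eq]
    exact (ProbabilityMeasure.continuous_prod.tendsto _).comp
      ((tendsto_gaussLaguerreProb.comp tendsto_fst).prodMk_nhds
        (tendsto_gaussLaguerreProb.comp tendsto_snd))
  refine ((ProbabilityMeasure.tendsto_iff_forall_integral_tendsto.1 h1) f).congr' ?_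
  filter_upwards [eventually_ge_atTop ((1, 1) : ℕ × ℕ)] with n hn
  obtain ⟨hn1, hn2⟩ : 1 ≤ n.1 ∧ 1 ≤ n.2 := hn
  have e1 : ((gaussLaguerreProb n.1).prod (gaussLaguerreProb n.2) : Measure (ℝ × ℝ)) =
      (gaussLaguerre n.1).prod (gaussLaguerre n.2) := by
    rw [ProbabilityMeasure.toMeasure_prod]
    simp only [gaussLaguerreProb, Nat.sub_add_cancel hn1, Nat.sub_add_cancel hn2,
      ProbabilityMeasure.coe_mk]
  have : IsProbabilityMeasure (gaussLaguerre n.1) := by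
    have := isProbabilityMeasure_gaussLaguerre (n.1 - 1)
    rwa [Nat.sub_add_cancel hn1] at this
  have : IsProbabilityMeasure (gaussLaguerre n.2) := by
    have := isProbabilityMeasure_gaussLaguerre (n.2 - 1)
    rwa [Nat.sub_add_cancel hn2] at this
  rw [e1, integral_prod _ (f.integrable _), integral_gaussLaguerre]
  refine Finset.sum_congr rfl fun σ _ => ?_
  rw [integral_gaussLaguerre, Finset.mul_sum]
  exact Finset.sum_congr rfl fun τ _ => by ring


/-! ### Order statistics -/

/-- In the sorted tuple the entries below t form an initial segment. Ranks start at 0, so more than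
k such entries are needed. -/
lemma orderStat_lt_iff {K : ℕ} (k : Fin K) (x : Fin K → ℝ) (t : ℝ) :
    orderStat k x < t ↔ (k : ℕ) < (Finset.univ.filter fun i => x i < t).card := by
  have h := Tuple.lt_card_lt_iff_apply_lt_of_monotone (j := k) (f := x ∘ Tuple.sort x) (a := t)
    (Tuple.monotone_sort x)
  rw [orderStat, ← Function.comp_apply (f := x), ← h]
  have hc : (Finset.univ.filter fun i => (x ∘ Tuple.sort x) i < t).card =
      (Finset.univ.filter fun i => x i < t).card :=
    Finset.card_equiv (Tuple.sort x) (by simp)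
  rw [hc]

/-- The probability that more than `k` out of `K` independent events of probability `p` occur. -/
def binomialTail (K k : ℕ) (p : ℝ) : ℝ :=
  ∑ m ∈ Finset.range (K + 1), if k < m then (K.choose m : ℝ) * p ^ m * (1 - p) ^ (K - m) else 0

lemma measure_pi_card_eq {K : ℕ} (ν : Measure ℝ) [IsProbabilityMeasure ν] {A : Set ℝ}
    (hA : MeasurableSet A) (s : Finset (Fin K)) :
    (Measure.pi fun _ : Fin K => ν).real {x | ∀ i, x i ∈ A ↔ i ∈ s} =
      ν.real A ^ s.card * (1 - ν.real A) ^ (K - s.card) := by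
  classical
  have hset : {x : Fin K → ℝ | ∀ i, x i ∈ A ↔ i ∈ s} =
      Set.univ.pi fun i => if i ∈ s then A else Aᶜ := by
    ext x
    simp only [Set.mem_ofPred_eq, Set.mem_univ_pi]
    refine forall_congr' fun i => ?_
    by_cases hi : i ∈ s <;> simp [hi]
  rw [hset, Measure.real, Measure.pi_pi, ENNReal.toReal_prod]
  have h : ∀ i, (ν (if i ∈ s then A else Aᶜ)).toReal =
      if i ∈ s then ν.real A else 1 - ν.real A := by
    intro i
    split_ifs
    · rfl
    · exact probReal_compl_eq_one_sub hA
  simp only [h]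
  rw [Finset.prod_ite, Finset.prod_const, Finset.prod_const]
  congr 2
  · simp
  · rw [Finset.filter_not, Finset.card_sdiff_of_subset (Finset.filter_subset _ _)]
    simp

/-- Partition by the exact set of indices whose entry is below t. Each piece is a box whose mass
depends only on the size of that set. -/
lemma measure_pi_lt_card {K : ℕ} (k : ℕ) (ν : Measure ℝ) [IsProbabilityMeasure ν] (t : ℝ) :
    (Measure.pi fun _ : Fin K => ν).real
      {x | k < (Finset.univ.filter fun i => x i < t).card} =
      binomialTail K k (ν.real (Set.Iio t)) := by
  have hset : {x : Fin K → ℝ | k < (Finset.univ.filter fun i => x i < t).card} =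
      ⋃ s ∈ (Finset.univ : Finset (Finset (Fin K))).filter (fun s => k < s.card),
        {x | ∀ i, x i ∈ Set.Iio t ↔ i ∈ s} := by
    ext x
    simp only [Set.mem_ofPred_eq, Set.mem_iUnion, Finset.mem_filter, Finset.mem_univ, true_and,
      exists_prop, Set.mem_Iio]
    constructor
    · exact fun h => ⟨_, h, by simp⟩
    · rintro ⟨s, hs, h⟩
      convert! hs
      ext i
      simp [h]
  rw [hset, measureReal_biUnion_finset]
  · simp only [measure_pi_card_eq ν measurableSet_Iio, Finset.sum_filter]
    have h := Finset.sum_powerset_apply_card (x := (Finset.univ : Finset (Fin K)))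
      (fun m => if k < m then
        ν.real (Set.Iio t) ^ m * (1 - ν.real (Set.Iio t)) ^ (K - m) else 0)
    rw [Finset.powerset_univ, Finset.card_univ, Fintype.card_fin] at h
    rw [h, binomialTail]
    refine Finset.sum_congr rfl fun m _ => ?_
    split_ifs
    · rw [nsmul_eq_mul, mul_assoc]
    · simp
  · intro s _ s' _ hne
    refine Set.disjoint_left.2 fun x hx hx' => hne ?_
    ext i
    exact (hx i).symm.trans (hx' i)
  · intro s _
    have : {x : Fin K → ℝ | ∀ i, x i ∈ Set.Iio t ↔ i ∈ s} =
        ⋂ i, {x | x i ∈ Set.Iio t ↔ i ∈ s} := by ext; simp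
    rw [this]
    refine MeasurableSet.iInter fun i => ?_
    have hm : MeasurableSet {x : Fin K → ℝ | x i ∈ Set.Iio t} :=
      measurable_pi_apply i measurableSet_Iio
    by_cases hi : i ∈ s
    · simpa only [hi, iff_true] using hm
    · simp only [hi, iff_false]
      exact hm.compl

/-- Counting entries below t writes the preimage of a half-line as a finite union of boxes, so
measurability of the sorting permutation is not needed. -/
lemma measurable_orderStat {K : ℕ} (k : Fin K) : Measurable (orderStat k) := by
  refine measurable_of_Iio fun t => ?_
  have : orderStat k ⁻¹' Set.Iio t =
      ⋃ s ∈ (Finset.univ : Finset (Finset (Fin K))).filter (fun s => (k : ℕ) < s.card),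
        ⋂ i ∈ s, {x | x i < t} := by
    ext x
    simp only [Set.mem_preimage, Set.mem_Iio, orderStat_lt_iff, Set.mem_iUnion, Finset.mem_filter,
      Finset.mem_univ, true_and, exists_prop, Set.mem_iInter, Set.mem_ofPred_eq]
    constructor
    · exact fun h => ⟨_, h, by simp⟩
    · rintro ⟨s, hs, h⟩
      exact hs.trans_le (Finset.card_le_card fun i hi => by simpa using h i hi)
  rw [this]
  exact Finset.measurableSet_biUnion _ fun s _ => Finset.measurableSet_biInter _ fun i _ =>
    measurable_pi_apply i measurableSet_Iio

instance {K : ℕ} (k : Fin K) (ν : Measure ℝ) [IsProbabilityMeasure ν] :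
    IsProbabilityMeasure (orderedLaw k ν) :=
  Measure.isProbabilityMeasure_map (measurable_orderStat k).aemeasurable

theorem orderedLaw_real_Iio {K : ℕ} (k : Fin K) (ν : Measure ℝ) [IsProbabilityMeasure ν] (t : ℝ) :
    (orderedLaw k ν).real (Set.Iio t) = binomialTail K k (ν.real (Set.Iio t)) := by
  rw [orderedLaw, map_measureReal_apply (measurable_orderStat k) measurableSet_Iio,
    ← measure_pi_lt_card]
  congr 1
  ext x
  exact orderStat_lt_iff k x t

/-! ### Binomial tails and Bernstein polynomials -/

lemma continuous_binomialTail (K k : ℕ) : Continuous (binomialTail K k) := by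
  refine continuous_finsetSum _ fun m _ => ?_
  split_ifs <;> fun_prop

lemma binomialTail_zero (K k : ℕ) : binomialTail K k 0 = 0 := by
  refine Finset.sum_eq_zero fun m _ => ?_
  split_ifs with h
  · rw [zero_pow (by omega)]; simp
  · rfl

lemma binomialTail_pos {K k : ℕ} (hk : k < K) {p : ℝ} (hp : 0 < p) (hp1 : p ≤ 1) :
    0 < binomialTail K k p := by
  have h : ∀ m ∈ Finset.range (K + 1), 0 ≤
      if k < m then (K.choose m : ℝ) * p ^ m * (1 - p) ^ (K - m) else 0 := fun m _ => by
    have : 0 ≤ 1 - p := by linarith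
    split_ifs <;> positivity
  refine lt_of_lt_of_le ?_ (Finset.single_le_sum h (Finset.self_mem_range_succ K))
  simp [hk, pow_pos hp]

lemma binomialTail_eq_eval_sum_bernstein {K k : ℕ} (hk : k < K) (p : ℝ) :
    binomialTail K k p =
      (∑ j ∈ Finset.range (K - k), bernsteinPolynomial ℝ K (k + j + 1)).eval p := by
  rw [binomialTail, ← Finset.sum_filter, Polynomial.eval_finsetSum]
  symm
  refine Finset.sum_bij (fun j _ => k + j + 1) (fun j hj => ?_) (fun _ _ _ _ h => by omega)
    (fun m hm => ?_) (fun j _ => ?_)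
  · simp only [Finset.mem_range, Finset.mem_filter] at hj ⊢
    omega
  · simp only [Finset.mem_range, Finset.mem_filter] at hm ⊢
    exact ⟨m - k - 1, by omega, by omega⟩
  · simp [bernsteinPolynomial]

/-- The derivative of each Bernstein polynomial is a difference of two of degree K-1, so the sum
telescopes; the upper end has index K and vanishes. -/
lemma derivative_sum_bernstein {K k : ℕ} (hk : k < K) :
    (∑ j ∈ Finset.range (K - k), bernsteinPolynomial ℝ K (k + j + 1)).derivative =
      K * bernsteinPolynomial ℝ (K - 1) k := by
  simp only [Polynomial.derivative_sum, bernsteinPolynomial.derivative_succ]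
  rw [← Finset.mul_sum]
  simp only [add_assoc]
  rw [Finset.sum_range_sub' fun j => bernsteinPolynomial ℝ (K - 1) (k + j),
    bernsteinPolynomial.eq_zero_of_lt ℝ (by omega : K - 1 < k + (K - k))]
  simp

/-- The distribution function of an order statistic as an alternating sum of powers. -/
theorem binomialTail_eq_alternating_sum {K k : ℕ} (hk : k < K) (p : ℝ) :
    binomialTail K k p =
      (K.factorial : ℝ) / (((K - (k + 1)).factorial : ℝ) * (k.factorial : ℝ)) *
        ∑ l ∈ Finset.range (K - (k + 1) + 1), ((K - (k + 1)).choose l : ℝ) *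
          ((-1 : ℝ) ^ l / ((k : ℝ) + 1 + l)) * p ^ (k + 1 + l) := by
  obtain ⟨N, rfl⟩ := Nat.exists_eq_add_of_lt hk
  have hN : k + N + 1 - (k + 1) = N := by omega
  rw [hN]
  set κ : ℝ := ((k + N + 1).factorial : ℝ) / ((N.factorial : ℝ) * (k.factorial : ℝ)) with hκ
  have hκ' : κ = (k + N + 1 : ℕ) * ((k + N).choose k : ℝ) := by
    have h := Nat.choose_mul_factorial_mul_factorial (Nat.le_add_right k N)
    rw [Nat.add_sub_cancel_left] at h
    rw [hκ, div_eq_iff (by positivity), Nat.factorial_succ, ← h]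
    push_cast
    ring
  set q : Polynomial ℝ := Polynomial.C κ * ∑ l ∈ Finset.range (N + 1),
    Polynomial.C ((N.choose l : ℝ) * ((-1 : ℝ) ^ l / ((k : ℝ) + 1 + l))) *
      Polynomial.X ^ (k + 1 + l) with hq
  -- Differentiating cancels the denominators k+1+l and leaves the binomial expansion of (1-X)^N, so
  -- the alternating sum and the tail have equal derivatives. Both vanish at 0.
  have hqd : q.derivative = (k + N + 1 : ℕ) * bernsteinPolynomial ℝ (k + N + 1 - 1) k := by
    rw [hq, Polynomial.derivative_C_mul, Polynomial.derivative_sum, bernsteinPolynomial,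
      Nat.add_sub_cancel, Nat.add_sub_cancel_left, hκ', sub_eq_neg_add, add_pow]
    simp only [one_pow, mul_one]
    rw [Polynomial.C_mul, mul_assoc]
    simp only [Polynomial.C_eq_natCast, mul_assoc]
    congr 2
    rw [Finset.mul_sum]
    refine Finset.sum_congr rfl fun l _ => ?_
    have hl : ((k : ℝ) + 1 + l) ≠ 0 := by positivity
    rw [Polynomial.derivative_C_mul, Polynomial.derivative_X_pow,
      neg_pow (Polynomial.X : Polynomial ℝ), ← mul_assoc, ← Polynomial.C_mul]
    have e : (N.choose l : ℝ) * ((-1 : ℝ) ^ l / ((k : ℝ) + 1 + l)) * ((k + 1 + l : ℕ) : ℝ) =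
        N.choose l * (-1) ^ l := by
      push_cast
      field_simp
    rw [e, show k + 1 + l - 1 = k + l by omega, pow_add]
    simp only [map_mul, map_natCast, map_pow, map_neg, map_one]
    ring
  set r : Polynomial ℝ :=
    ∑ j ∈ Finset.range (k + N + 1 - k), bernsteinPolynomial ℝ (k + N + 1) (k + j + 1) with hr
  have hrd := derivative_sum_bernstein hk
  rw [← hr] at hrd
  have hsub : (r - q).derivative = 0 := by
    rw [Polynomial.derivative_sub, hrd, hqd, sub_self]
  have hC := Polynomial.eq_C_of_natDegree_eq_zero
    (Polynomial.derivative_eq_zero.1 hsub)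
  have h0 : (r - q).coeff 0 = 0 := by
    rw [Polynomial.coeff_zero_eq_eval_zero, Polynomial.eval_sub, hr,
      ← binomialTail_eq_eval_sum_bernstein hk, binomialTail_zero, hq]
    simp [Polynomial.eval_finsetSum]
  rw [h0, Polynomial.C_0, sub_eq_zero] at hC
  rw [binomialTail_eq_eval_sum_bernstein hk, ← hr, hC, hq]
  simp [Polynomial.eval_finsetSum]

/-- Near `0`, the distribution function of the order statistic behaves as its leading term. -/
theorem isEquivalent_binomialTail {K k : ℕ} (hk : k < K) :
    Asymptotics.IsEquivalent (𝓝[>] 0) (binomialTail K k)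
      fun p => (K.factorial : ℝ) / (((K - (k + 1)).factorial : ℝ) * (k.factorial : ℝ)) /
        ((k : ℝ) + 1) * p ^ (k + 1) := by
  set N := K - (k + 1)
  set κ : ℝ := (K.factorial : ℝ) / ((N.factorial : ℝ) * (k.factorial : ℝ)) with hκ
  have hκ0 : κ ≠ 0 := by positivity
  rw [Asymptotics.isEquivalent_iff_tendsto_one]
  -- After division by the leading power only the term l = 0, equal to 1/(k+1), survives at p = 0.
  · have h : Tendsto (fun p : ℝ => ((k : ℝ) + 1) * ∑ l ∈ Finset.range (N + 1), (N.choose l : ℝ) *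
        ((-1 : ℝ) ^ l / ((k : ℝ) + 1 + l)) * p ^ l) (𝓝[>] 0) (𝓝 1) := by
      have hc : Continuous (fun p : ℝ => ((k : ℝ) + 1) * ∑ l ∈ Finset.range (N + 1),
        (N.choose l : ℝ) * ((-1 : ℝ) ^ l / ((k : ℝ) + 1 + l)) * p ^ l) := by fun_prop
      have h1 := (hc.tendsto 0).mono_left (nhdsWithin_le_nhds (s := Set.Ioi 0))
      convert! h1 using 2
      rw [Finset.sum_range_succ']
      have : ((k : ℝ) + 1) ≠ 0 := by positivity
      simp [this]
    refine h.congr' ?_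
    filter_upwards [self_mem_nhdsWithin] with p hp
    have hp0 : p ≠ 0 := ne_of_gt hp
    have hk0 : ((k : ℝ) + 1) ≠ 0 := by positivity
    rw [Pi.div_apply, binomialTail_eq_alternating_sum hk, ← hκ]
    simp only [pow_add p (k + 1)]
    have : ∑ l ∈ Finset.range (N + 1), (N.choose l : ℝ) *
        ((-1 : ℝ) ^ l / ((k : ℝ) + 1 + l)) * (p ^ (k + 1) * p ^ l) =
        p ^ (k + 1) * ∑ l ∈ Finset.range (N + 1), (N.choose l : ℝ) *
        ((-1 : ℝ) ^ l / ((k : ℝ) + 1 + l)) * p ^ l := by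
      rw [Finset.mul_sum]
      exact Finset.sum_congr rfl fun l _ => by ring
    rw [this]
    field_simp
  · filter_upwards [self_mem_nhdsWithin] with p hp
    have hp0 : p ≠ 0 := ne_of_gt hp
    have hk0 : ((k : ℝ) + 1) ≠ 0 := by positivity
    positivity


/-! ### Characteristic functions of gamma and complex Gaussian laws -/

lemma integral_pow_gammaLaw (m j : ℕ) :
    ∫ x : ℝ, x ^ j ∂gammaLaw m = ((m + j).factorial : ℝ) / m.factorial := by
  rw [integral_gammaLaw, ← integral_pow_mul_exp_neg (m + j), ← integral_div]
  refine setIntegral_congr_fun measurableSet_Ioi fun x _ => ?_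
  simp only [smul_eq_mul, pow_add]
  ring

lemma integrableOn_pow_mul_cexp (m : ℕ) (t : ℝ) :
    IntegrableOn (fun x : ℝ => (x : ℂ) ^ m * Complex.exp (-(1 - (t : ℂ) * Complex.I) * x))
      (Set.Ioi 0) := by
  refine (integrableOn_pow_mul_exp_neg m).norm.mono' (by fun_prop) (ae_of_all _ fun x => ?_)
  rw [norm_mul, norm_mul, Complex.norm_exp, ← Complex.ofReal_pow, Complex.norm_real,
    Real.norm_of_nonneg (Real.exp_pos _).le]
  simp

/-- Integrating the derivative of x^(m+1) exp(-cx), with c = 1 - it, over the half-line gives c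
I_{m+1} = (m+1) I_m. -/
lemma integral_pow_mul_cexp (m : ℕ) (t : ℝ) :
    ∫ x in Set.Ioi (0 : ℝ), (x : ℂ) ^ m * Complex.exp (-(1 - (t : ℂ) * Complex.I) * x) =
      m.factorial * (1 / (1 - t * Complex.I)) ^ (m + 1) := by
  have hre : (-(1 - (t : ℂ) * Complex.I)).re < 0 := by simp
  have hne : (1 - (t : ℂ) * Complex.I) ≠ 0 := fun h => by
    rw [h] at hre
    simp at hre
  induction m with
  | zero =>
    simp only [pow_zero, one_mul]
    rw [integral_exp_mul_complex_Ioi hre 0]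
    simp only [Complex.ofReal_zero, mul_zero, Complex.exp_zero, Nat.factorial_zero, Nat.cast_one,
      zero_add, pow_one, one_mul, neg_div_neg_eq]
  | succ m ih =>
    have hd : ∀ x : ℝ, HasDerivAt
        (fun x : ℝ => (x : ℂ) ^ (m + 1) * Complex.exp (-(1 - (t : ℂ) * Complex.I) * x))
        ((m + 1) * ((x : ℂ) ^ m * Complex.exp (-(1 - (t : ℂ) * Complex.I) * x)) -
          (1 - (t : ℂ) * Complex.I) *
            ((x : ℂ) ^ (m + 1) * Complex.exp (-(1 - (t : ℂ) * Complex.I) * x))) x := by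
      intro x
      have h1 := (Complex.ofRealCLM.hasDerivAt (x := x)).pow (m + 1)
      have h2 := ((Complex.ofRealCLM.hasDerivAt (x := x)).const_mul
        (-(1 - (t : ℂ) * Complex.I))).cexp
      refine (h1.mul h2).congr_deriv ?_
      simp
      ring
    have hlim : Tendsto
        (fun x : ℝ => (x : ℂ) ^ (m + 1) * Complex.exp (-(1 - (t : ℂ) * Complex.I) * x)) atTop
        (𝓝 0) := by
      rw [tendsto_zero_iff_norm_tendsto_zero]
      refine (Real.tendsto_pow_mul_exp_neg_atTop_nhds_zero (m + 1)).congr' ?_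
      filter_upwards [eventually_ge_atTop 0] with x hx
      rw [norm_mul, Complex.norm_exp, ← Complex.ofReal_pow, Complex.norm_real,
        Real.norm_of_nonneg (by positivity)]
      simp
    have h := integral_Ioi_of_hasDerivAt_of_tendsto (a := 0) (hd 0).continuousAt.continuousWithinAt
      (fun x _ => hd x) (((integrableOn_pow_mul_cexp m t).const_mul _).sub
        ((integrableOn_pow_mul_cexp (m + 1) t).const_mul _)) hlim
    rw [integral_sub ((integrableOn_pow_mul_cexp m t).const_mul _)
      ((integrableOn_pow_mul_cexp (m + 1) t).const_mul _), integral_const_mul, integral_const_mul,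
      ih] at h
    have h' : (1 - (t : ℂ) * Complex.I) *
        ∫ x in Set.Ioi (0 : ℝ), (x : ℂ) ^ (m + 1) *
          Complex.exp (-(1 - (t : ℂ) * Complex.I) * x) =
        (m + 1) * (m.factorial * (1 / (1 - t * Complex.I)) ^ (m + 1)) := by
      simp only [Complex.ofReal_zero, ne_eq, Nat.add_one_ne_zero, not_false_eq_true, zero_pow,
        zero_mul, sub_self] at h
      linear_combination -h
    rw [eq_comm, ← mul_right_inj' hne, h', Nat.factorial_succ, pow_succ _ (m + 1)]
    push_cast
    field_simp

lemma charFun_gammaLaw (m : ℕ) (t : ℝ) :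
    charFun (gammaLaw m) t = (1 / (1 - t * Complex.I)) ^ (m + 1) := by
  have hf : (m.factorial : ℂ) ≠ 0 := by exact_mod_cast m.factorial_ne_zero
  rw [charFun_apply_real, integral_gammaLaw]
  have e : ∀ x ∈ Set.Ioi (0 : ℝ), (x ^ m * Real.exp (-x) / m.factorial) •
      Complex.exp (t * x * Complex.I) =
      (m.factorial : ℂ)⁻¹ *
        ((x : ℂ) ^ m * Complex.exp (-(1 - (t : ℂ) * Complex.I) * x)) := by
    intro x _
    have : -(1 - (t : ℂ) * Complex.I) * x = ((-x : ℝ) : ℂ) + t * x * Complex.I := by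
      push_cast; ring
    rw [Complex.real_smul, this, Complex.exp_add]
    push_cast
    ring
  rw [setIntegral_congr_fun measurableSet_Ioi e, integral_const_mul, integral_pow_mul_cexp,
    inv_mul_cancel_left₀ hf]

lemma gammaLaw_zero_real_Ici {a : ℝ} (ha : 0 ≤ a) :
    (gammaLaw 0).real (Set.Ici a) = Real.exp (-a) := by
  rw [← integral_indicator_one measurableSet_Ici, integral_gammaLaw, ← integral_exp_neg_Ioi,
    ← integral_indicator measurableSet_Ioi, ← integral_indicator measurableSet_Ioi]
  refine integral_congr_ae ?_
  filter_upwards [Measure.ae_ne volume 0, Measure.ae_ne volume a] with x hx hxa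
  by_cases h : a < x
  · simp [Set.indicator, h, h.le, ha.trans_lt h]
  · have h' : ¬a ≤ x := fun h' => h (lt_of_le_of_ne h' (Ne.symm hxa))
    simp [Set.indicator, h, h']

/-! ### Complex Gaussian vectors: linear forms and energies -/

lemma measurable_complexMk : Measurable (fun z : ℝ × ℝ => (⟨z.1, z.2⟩ : ℂ)) :=
  Complex.measurableEquivRealProd.symm.measurable

instance (N : ℝ) : IsProbabilityMeasure (complexGaussian N) :=
  Measure.isProbabilityMeasure_map measurable_complexMk.aemeasurable

instance (P Q : ℕ) (N : ℝ) : IsProbabilityMeasure (channelLaw P Q N) := by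
  unfold channelLaw; infer_instance

lemma charFun_complexGaussian {N : ℝ} (hN : 0 ≤ N) (t : ℂ) :
    charFun (complexGaussian N) t = Complex.exp (-(N * ‖t‖ ^ 2 / 4 : ℝ)) := by
  rw [charFun_apply, complexGaussian, integral_map measurable_complexMk.aemeasurable
    (by fun_prop)]
  have e : ∀ z : ℝ × ℝ, Complex.exp ((inner ℝ (⟨z.1, z.2⟩ : ℂ) t : ℝ) * Complex.I) =
      Complex.exp (t.re * z.1 * Complex.I) * Complex.exp (t.im * z.2 * Complex.I) := by
    intro z
    rw [← Complex.exp_add, Complex.inner]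
    congr 1
    simp
    ring
  simp_rw [e]
  rw [integral_prod_mul (fun x : ℝ => Complex.exp (t.re * x * Complex.I))
    (fun y : ℝ => Complex.exp (t.im * y * Complex.I)), ← charFun_apply_real, ← charFun_apply_real,
    charFun_gaussianReal, charFun_gaussianReal, ← Complex.exp_add, Complex.sq_norm,
    Complex.normSq_apply, Real.coe_toNNReal _ (by positivity)]
  congr 1
  push_cast
  ring

/-- Multiplication by c_i moves to the frequency as conj(c_i), so the characteristic function
factors over the coordinates and the exponents add. -/
theorem map_sum_mul_pi_complexGaussian {ι : Type*} [Fintype ι] {N : ℝ} (hN : 0 ≤ N) (c : ι → ℂ) :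
    (Measure.pi fun _ : ι => complexGaussian N).map (fun z => ∑ i, c i * z i) =
      complexGaussian (N * ∑ i, ‖c i‖ ^ 2) := by
  have hm : Measurable (fun z : ι → ℂ => ∑ i, c i * z i) := by fun_prop
  have : IsProbabilityMeasure ((Measure.pi fun _ : ι => complexGaussian N).map
    (fun z => ∑ i, c i * z i)) := Measure.isProbabilityMeasure_map hm.aemeasurable
  refine Measure.ext_of_charFun (funext fun t => ?_)
  rw [charFun_complexGaussian (by positivity), charFun_apply, integral_map hm.aemeasurable
    (by fun_prop)]
  have e : ∀ z : ι → ℂ, Complex.exp ((inner ℝ (∑ i, c i * z i) t : ℝ) * Complex.I) =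
      ∏ i, Complex.exp ((inner ℝ (z i) ((starRingEnd ℂ) (c i) * t) : ℝ) * Complex.I) := by
    intro z
    rw [← Complex.exp_sum, sum_inner, Complex.ofReal_sum, Finset.sum_mul]
    refine congrArg Complex.exp (Finset.sum_congr rfl fun i _ => ?_)
    rw [Complex.inner, Complex.inner, map_mul]
    congr 3
    ring
  simp_rw [e]
  rw [integral_fintype_prod_eq_prod (μ := fun _ => complexGaussian N) (fun i z =>
    Complex.exp ((inner ℝ z ((starRingEnd ℂ) (c i) * t) : ℝ) * Complex.I))]
  simp_rw [← charFun_apply, charFun_complexGaussian hN]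
  rw [← Complex.exp_sum, ← Complex.ofReal_neg, Finset.mul_sum, Finset.sum_mul, Finset.sum_div]
  congr 1
  push_cast
  rw [← Finset.sum_neg_distrib]
  refine Finset.sum_congr rfl fun i _ => ?_
  simp
  ring

/-- The real and imaginary parts contribute the same Gaussian integral with complex parameter (1 -
it)/N. Only its square occurs, so no branch of the square root has to be chosen. -/
lemma integral_exp_normSq_complexGaussian {N : ℝ} (hN : 0 < N) (t : ℝ) :
    ∫ z, Complex.exp (t * (‖z‖ ^ 2 / N : ℝ) * Complex.I) ∂complexGaussian N =
      1 / (1 - t * Complex.I) := by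
  rw [complexGaussian, integral_map measurable_complexMk.aemeasurable (by fun_prop)]
  have hv : (N / 2).toNNReal ≠ 0 := by simpa using hN
  have hN' : (N : ℂ) ≠ 0 := by exact_mod_cast hN.ne'
  have e : ∀ z : ℝ × ℝ, Complex.exp (t * (‖(⟨z.1, z.2⟩ : ℂ)‖ ^ 2 / N : ℝ) * Complex.I) =
      Complex.exp (t * (z.1 ^ 2 / N : ℝ) * Complex.I) *
        Complex.exp (t * (z.2 ^ 2 / N : ℝ) * Complex.I) := by
    intro z
    rw [← Complex.exp_add, Complex.sq_norm, Complex.normSq_mk]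
    congr 1
    push_cast
    ring
  simp_rw [e]
  rw [integral_prod_mul (fun x : ℝ => Complex.exp (t * (x ^ 2 / N : ℝ) * Complex.I))
    (fun x : ℝ => Complex.exp (t * (x ^ 2 / N : ℝ) * Complex.I)), ← sq,
    integral_gaussianReal_eq_integral_smul hv]
  have e2 : ∀ x : ℝ, gaussianPDFReal 0 (N / 2).toNNReal x •
      Complex.exp (t * (x ^ 2 / N : ℝ) * Complex.I) =
      (((√(Real.pi * N))⁻¹ : ℝ) : ℂ) * Complex.exp (-((1 - t * Complex.I) / N) * (x : ℂ) ^ 2) := by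
    intro x
    rw [gaussianPDFReal, Real.coe_toNNReal _ (by positivity), Complex.real_smul]
    have h1 : 2 * Real.pi * (N / 2) = Real.pi * N := by ring
    have h2 : -((1 - t * Complex.I) / N) * (x : ℂ) ^ 2 =
        ((-(x - 0) ^ 2 / (2 * (N / 2)) : ℝ) : ℂ) + t * (x ^ 2 / N : ℝ) * Complex.I := by
      push_cast
      field_simp
      ring
    rw [h1, h2, Complex.exp_add]
    push_cast
    ring
  simp_rw [e2]
  rw [integral_const_mul, mul_pow, integral_gaussian_sq_complex, ← Complex.ofReal_pow, inv_pow,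
    Real.sq_sqrt (by positivity)]
  · have hpi : (Real.pi : ℂ) ≠ 0 := by exact_mod_cast Real.pi_ne_zero
    push_cast
    field_simp
  · rw [show (1 - t * Complex.I) / (N : ℂ) = ((1 / N : ℝ) : ℂ) - ((t / N : ℝ) : ℂ) * Complex.I by
      push_cast; ring]
    simp [hN]

lemma map_normSq_complexGaussian {N : ℝ} (hN : 0 < N) :
    (complexGaussian N).map (fun z => ‖z‖ ^ 2 / N) = gammaLaw 0 := by
  have hm : Measurable (fun z : ℂ => ‖z‖ ^ 2 / N) := by fun_prop
  have : IsProbabilityMeasure ((complexGaussian N).map (fun z => ‖z‖ ^ 2 / N)) :=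
    Measure.isProbabilityMeasure_map hm.aemeasurable
  refine Measure.ext_of_charFun (funext fun t => ?_)
  rw [charFun_gammaLaw, charFun_apply_real, integral_map hm.aemeasurable (by fun_prop),
    integral_exp_normSq_complexGaussian hN]
  simp

/-- The normalised energy of `m + 1` complex Gaussian coordinates has a gamma law. -/
theorem map_sum_normSq_pi_complexGaussian {ι : Type*} [Fintype ι] {N : ℝ} (hN : 0 < N)
    (s : Finset ι) {m : ℕ} (hs : s.card = m + 1) :
    (Measure.pi fun _ : ι => complexGaussian N).map (fun z => ∑ i ∈ s, ‖z i‖ ^ 2 / N) =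
      gammaLaw m := by
  classical
  have hm : Measurable (fun z : ι → ℂ => ∑ i ∈ s, ‖z i‖ ^ 2 / N) := by fun_prop
  have : IsProbabilityMeasure ((Measure.pi fun _ : ι => complexGaussian N).map
    (fun z => ∑ i ∈ s, ‖z i‖ ^ 2 / N)) := Measure.isProbabilityMeasure_map hm.aemeasurable
  refine Measure.ext_of_charFun (funext fun t => ?_)
  rw [charFun_gammaLaw, charFun_apply_real, integral_map hm.aemeasurable (by fun_prop)]
  have e : ∀ z : ι → ℂ, Complex.exp (t * (∑ i ∈ s, ‖z i‖ ^ 2 / N : ℝ) * Complex.I) =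
      ∏ i, if i ∈ s then Complex.exp (t * (‖z i‖ ^ 2 / N : ℝ) * Complex.I) else 1 := by
    intro z
    rw [Finset.prod_ite_mem, Finset.univ_inter, ← Complex.exp_sum, Complex.ofReal_sum,
      Finset.mul_sum, Finset.sum_mul]
  simp_rw [e]
  rw [integral_fintype_prod_eq_prod (μ := fun _ => complexGaussian N) (fun i z =>
    if i ∈ s then Complex.exp (t * (‖z‖ ^ 2 / N : ℝ) * Complex.I) else 1)]
  have e2 : ∀ i, ∫ z, (if i ∈ s then Complex.exp (t * (‖z‖ ^ 2 / N : ℝ) * Complex.I) else 1)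
      ∂complexGaussian N = if i ∈ s then 1 / (1 - t * Complex.I) else 1 := by
    intro i
    split_ifs
    · exact integral_exp_normSq_complexGaussian hN t
    · simp
  simp_rw [e2]
  rw [Finset.prod_ite_mem, Finset.univ_inter, Finset.prod_const, hs]

lemma complexGaussian_real_le_normSq {N x : ℝ} (hN : 0 < N) (hx : 0 ≤ x) :
    (complexGaussian N).real {z | x ≤ ‖z‖ ^ 2} = Real.exp (-x / N) := by
  have hm : Measurable (fun z : ℂ => ‖z‖ ^ 2 / N) := by fun_prop
  rw [neg_div, ← gammaLaw_zero_real_Ici (div_nonneg hx hN.le), ← map_normSq_complexGaussian hN,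
    map_measureReal_apply hm measurableSet_Ici]
  congr 1
  ext z
  exact (div_le_div_iff_of_pos_right hN).symm

lemma integrable_normSq_complexGaussian {N : ℝ} (hN : 0 < N) :
    Integrable (fun z => ‖z‖ ^ 2) (complexGaussian N) := by
  have hm : Measurable (fun z : ℂ => ‖z‖ ^ 2 / N) := by fun_prop
  have h := integrable_pow_gammaLaw 0 1
  rw [← map_normSq_complexGaussian hN, integrable_map_measure (by fun_prop) hm.aemeasurable] at h
  refine (h.const_mul N).congr (ae_of_all _ fun z => ?_)
  simp only [Function.comp_apply, pow_one]
  field_simp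

lemma integral_normSq_complexGaussian {N : ℝ} (hN : 0 < N) :
    ∫ z, ‖z‖ ^ 2 ∂complexGaussian N = N := by
  have hm : Measurable (fun z : ℂ => ‖z‖ ^ 2 / N) := by fun_prop
  have h := integral_pow_gammaLaw 0 1
  rw [← map_normSq_complexGaussian hN, integral_map hm.aemeasurable (by fun_prop)] at h
  simp only [pow_one, integral_div] at h
  field_simp at h
  simpa using h

/-! ### The cascaded channel -/

lemma cascadedChannel_eq_sum {P Q : ℕ} (p : Fin P) (hr hbr : Fin P × Fin Q → ℂ) :
    cascadedChannel p hr hbr =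
      ∑ m, (if m.1 = p then (starRingEnd ℂ) (hr m) else 0) * hbr m := by
  simp only [cascadedChannel, dotProduct, Matrix.mulVec_diagonal, Pi.star_apply]
  refine Finset.sum_congr rfl fun m _ => ?_
  simp only [onOffMatrix, Matrix.kroneckerMap_apply, Matrix.one_apply, Matrix.of_apply, mul_one]
  split_ifs <;> simp

/-- The elements of the `p`-th column. -/
def columnElements {P : ℕ} (Q : ℕ) (p : Fin P) : Finset (Fin P × Fin Q) :=
  Finset.univ.filter fun m => m.1 = p

lemma card_columnElements {P : ℕ} (Q : ℕ) (p : Fin P) : (columnElements Q p).card = Q := by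
  have : columnElements Q p = ({p} : Finset (Fin P)) ×ˢ (Finset.univ : Finset (Fin Q)) := by
    ext m
    rw [columnElements, Finset.mem_filter, Finset.mem_product, Finset.mem_singleton]
    simp
  rw [this, Finset.card_product]
  simp

/-- The energy of the RIS-user channel in the `p`-th column. -/
def columnEnergy {P Q : ℕ} (p : Fin P) (hr : Fin P × Fin Q → ℂ) : ℝ :=
  ∑ m ∈ columnElements Q p, ‖hr m‖ ^ 2

/-- For frozen `hr` the channel is a linear form in the Gaussian vector, with coefficients conj(hr)
on column p and 0 elsewhere. -/
lemma map_cascadedChannel {P Q : ℕ} (p : Fin P) {N : ℝ} (hN : 0 ≤ N)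
    (hr : Fin P × Fin Q → ℂ) :
    (channelLaw P Q N).map (cascadedChannel p hr) =
      complexGaussian (N * columnEnergy p hr) := by
  have h := map_sum_mul_pi_complexGaussian hN
    (fun m : Fin P × Fin Q => if m.1 = p then (starRingEnd ℂ) (hr m) else 0)
  simp only [← cascadedChannel_eq_sum] at h
  rw [channelLaw, show cascadedChannel p hr = fun z => cascadedChannel p hr z from rfl, h]
  congr 2
  rw [columnEnergy, columnElements, Finset.sum_filter]
  refine Finset.sum_congr rfl fun m _ => ?_
  split_ifs <;> simp

lemma measurable_cascadedChannel {P Q : ℕ} (p : Fin P) :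
    Measurable fun h : (Fin P × Fin Q → ℂ) × (Fin P × Fin Q → ℂ) =>
      cascadedChannel p h.2 h.1 := by
  simp only [cascadedChannel_eq_sum]
  refine Finset.measurable_sum _ fun m _ => ?_
  split_ifs <;> fun_prop

lemma measurable_cascadedChannel_left {P Q : ℕ} (p : Fin P) (hr : Fin P × Fin Q → ℂ) :
    Measurable (cascadedChannel p hr) := by
  change Measurable fun z => cascadedChannel p hr z
  simp only [cascadedChannel_eq_sum]
  fun_prop

lemma measurable_columnEnergy {P Q : ℕ} (p : Fin P) :
    Measurable (columnEnergy (Q := Q) p) := by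
  unfold columnEnergy; fun_prop

lemma map_columnEnergy {P m : ℕ} (p : Fin P) {N : ℝ} (hN : 0 < N) :
    (channelLaw P (m + 1) N).map (fun h => columnEnergy p h / N) = gammaLaw m := by
  simp only [columnEnergy, Finset.sum_div]
  exact map_sum_normSq_pi_complexGaussian hN _ (card_columnElements _ p)

lemma ae_columnEnergy_pos {P m : ℕ} (p : Fin P) {N : ℝ} (hN : 0 < N) :
    ∀ᵐ h ∂channelLaw P (m + 1) N, 0 < columnEnergy p h := by
  have h := ae_gammaLaw_pos m
  rw [← map_columnEnergy p hN] at h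
  refine (ae_of_ae_map ((measurable_columnEnergy p).div_const N).aemeasurable h).mono
    fun z hz => ?_
  exact (div_pos_iff_of_pos_right hN).1 hz

lemma measureReal_prod_eq_integral_symm {α β : Type*} [MeasurableSpace α] [MeasurableSpace β]
    (μ : Measure α) (ν : Measure β) [IsProbabilityMeasure μ] [IsProbabilityMeasure ν]
    {s : Set (α × β)} (hs : MeasurableSet s) :
    (μ.prod ν).real s = ∫ y, μ.real {x | (x, y) ∈ s} ∂ν := by
  rw [Measure.real, Measure.prod_apply_symm hs, ← integral_toReal]
  · rfl
  · exact (measurable_measure_prodMk_right hs).aemeasurable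
  · exact ae_of_all _ fun _ => measure_lt_top _ _

/-- The complementary distribution function of the product of an exponential variable and an
independent gamma variable of shape `m + 1`. -/
def cascadedTail (m : ℕ) (z : ℝ) : ℝ := ∫ y, Real.exp (-z / y) ∂gammaLaw m

instance {P : ℕ} (Q : ℕ) (p : Fin P) (Nbr Nr : ℝ) :
    IsProbabilityMeasure (cascadedGainLaw Q p Nbr Nr) :=
  Measure.isProbabilityMeasure_map ((measurable_cascadedChannel p).norm.pow_const 2).aemeasurable

/-- Given the second channel, the gain is exponential with mean N_br times the column energy, and
this energy over N_r has a gamma law. The degenerate case of zero energy is null. -/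
theorem cascadedGainLaw_real_Iio {P m : ℕ} (p : Fin P) {Nbr Nr x : ℝ} (hbr : 0 < Nbr)
    (hr : 0 < Nr) (hx : 0 ≤ x) :
    (cascadedGainLaw (m + 1) p Nbr Nr).real (Set.Iio x) =
      1 - cascadedTail m (x / (Nbr * Nr)) := by
  have hmeas := (measurable_cascadedChannel (Q := m + 1) p).norm.pow_const 2
  have hm2 : Measurable fun h : Fin P × Fin (m + 1) → ℂ => columnEnergy p h / Nr :=
    (measurable_columnEnergy p).div_const Nr
  rw [← Set.compl_Ici, probReal_compl_eq_one_sub measurableSet_Ici]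
  congr 1
  rw [cascadedGainLaw, map_measureReal_apply hmeas measurableSet_Ici,
    measureReal_prod_eq_integral_symm _ _ (hmeas measurableSet_Ici), cascadedTail,
    ← map_columnEnergy p hr, integral_map hm2.aemeasurable (by fun_prop)]
  refine integral_congr_ae ?_
  filter_upwards [ae_columnEnergy_pos p hr] with h hh
  have hmc := measurable_cascadedChannel_left p h
  have e := complexGaussian_real_le_normSq (mul_pos hbr hh) hx
  rw [← map_cascadedChannel p hbr.le h, map_measureReal_apply hmc
    (measurableSet_le measurable_const (by fun_prop))] at e
  refine Eq.trans ?_ (e.trans ?_)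
  · rfl
  · congr 1
    field_simp

/-- The same conditioning gives N_br times the mean column energy, and a gamma law of shape m+1 has
mean m+1. -/
theorem integral_cascadedGainLaw {P m : ℕ} (p : Fin P) {Nbr Nr : ℝ} (hbr : 0 < Nbr)
    (hr : 0 < Nr) :
    ∫ g, g ∂cascadedGainLaw (m + 1) p Nbr Nr = (m + 1 : ℕ) * Nbr * Nr := by
  have hmeas := (measurable_cascadedChannel (Q := m + 1) p).norm.pow_const 2
  have hm2 : Measurable fun h : Fin P × Fin (m + 1) → ℂ => columnEnergy p h / Nr :=
    (measurable_columnEnergy p).div_const Nr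
  have hcond : ∀ᵐ h ∂channelLaw P (m + 1) Nr,
      Integrable (fun z => ‖cascadedChannel p h z‖ ^ 2) (channelLaw P (m + 1) Nbr) ∧
      ∫ z, ‖cascadedChannel p h z‖ ^ 2 ∂channelLaw P (m + 1) Nbr = Nbr * columnEnergy p h := by
    filter_upwards [ae_columnEnergy_pos p hr] with h hh
    have hmc := measurable_cascadedChannel_left p h
    have e1 := integrable_normSq_complexGaussian (mul_pos hbr hh)
    have e2 := integral_normSq_complexGaussian (mul_pos hbr hh)
    have e3 : ∫ z, ‖z‖ ^ 2 ∂(channelLaw P (m + 1) Nbr).map (cascadedChannel p h) =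
        Nbr * columnEnergy p h := by
      rw [map_cascadedChannel p hbr.le h, e2]
    rw [← map_cascadedChannel p hbr.le h] at e1
    exact ⟨e1.comp_measurable hmc, by rw [← e3, integral_map hmc.aemeasurable (by fun_prop)]⟩
  have hE : Integrable (fun h => columnEnergy p h / Nr) (channelLaw P (m + 1) Nr) ∧
      ∫ h, columnEnergy p h / Nr ∂channelLaw P (m + 1) Nr = (m + 1 : ℕ) := by
    have e1 := integrable_pow_gammaLaw m 1
    have e2 := integral_pow_gammaLaw m 1
    rw [← map_columnEnergy p hr] at e1 e2
    rw [integrable_map_measure (by fun_prop) hm2.aemeasurable] at e1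
    rw [integral_map hm2.aemeasurable (by fun_prop), Nat.factorial_succ] at e2
    refine ⟨by simpa [Function.comp_def] using e1, ?_⟩
    simp only [pow_one] at e2
    rw [e2]
    push_cast
    field_simp
  rw [cascadedGainLaw, integral_map hmeas.aemeasurable (by fun_prop), integral_prod_symm]
  · rw [integral_congr_ae (hcond.mono fun h hh => hh.2)]
    have : ∀ h : Fin P × Fin (m + 1) → ℂ,
        Nbr * columnEnergy p h = Nbr * Nr * (columnEnergy p h / Nr) := by
      intro h; field_simp
    simp_rw [this]
    rw [integral_const_mul, hE.2]
    ring
  · rw [integrable_prod_iff' hmeas.aestronglyMeasurable]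
    refine ⟨hcond.mono fun h hh => hh.1, ?_⟩
    refine (hE.1.const_mul (Nbr * Nr)).congr ?_
    filter_upwards [hcond] with h hh
    simp only [norm_pow, norm_norm]
    rw [hh.2]
    field_simp


/-! ### The tail of the cascaded gain -/

lemma exp_neg_div_le_one {z y : ℝ} (hz : 0 ≤ z) (hy : 0 < y) : Real.exp (-z / y) ≤ 1 := by
  rw [Real.exp_le_one_iff, neg_div]
  exact neg_nonpos.2 (div_nonneg hz hy.le)

lemma integrable_exp_neg_div (m : ℕ) {z : ℝ} (hz : 0 ≤ z) :
    Integrable (fun y => Real.exp (-z / y)) (gammaLaw m) := by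
  refine (integrable_const (1 : ℝ)).mono' (by fun_prop) ?_
  filter_upwards [ae_gammaLaw_pos m] with y hy
  rw [Real.norm_of_nonneg (Real.exp_pos _).le]
  exact exp_neg_div_le_one hz hy

/-- Clipping at 0 keeps the integrand bounded by 1, so dominated convergence gives continuity on the
whole line. -/
lemma continuous_cascadedTail_max (m : ℕ) : Continuous fun z => cascadedTail m (max z 0) := by
  unfold cascadedTail
  refine continuous_of_dominated (bound := fun _ => 1) (fun z => by fun_prop) (fun z => ?_)
    (integrable_const _) ?_
  · filter_upwards [ae_gammaLaw_pos m] with y hy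
    rw [Real.norm_of_nonneg (Real.exp_pos _).le]
    exact exp_neg_div_le_one (le_max_right _ _) hy
  · exact ae_of_all _ fun y => by fun_prop

lemma cascadedTail_zero (m : ℕ) : cascadedTail m 0 = 1 := by simp [cascadedTail]

lemma cascadedTail_nonneg (m : ℕ) (z : ℝ) : 0 ≤ cascadedTail m z :=
  integral_nonneg fun _ => (Real.exp_pos _).le

lemma one_sub_cascadedTail (m : ℕ) {z : ℝ} (hz : 0 ≤ z) :
    1 - cascadedTail m z = ∫ y, (1 - Real.exp (-z / y)) ∂gammaLaw m := by
  rw [integral_sub (integrable_const _) (integrable_exp_neg_div m hz), cascadedTail]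
  simp

lemma integral_pos_of_ae_pos {α : Type*} [MeasurableSpace α] {μ : Measure α}
    [IsProbabilityMeasure μ] {f : α → ℝ} (hf : Integrable f μ) (hpos : ∀ᵐ x ∂μ, 0 < f x) :
    0 < ∫ x, f x ∂μ := by
  rw [integral_pos_iff_support_of_nonneg_ae (hpos.mono fun _ h => h.le) hf]
  have h1 : μ (Function.support f) = 1 :=
    (measure_congr (eventuallyEq_univ.2 (hpos.mono fun _ h => h.ne'))).trans measure_univ
  rw [h1]
  exact one_pos

lemma cascadedTail_lt_one (m : ℕ) {z : ℝ} (hz : 0 < z) : cascadedTail m z < 1 := by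
  rw [← sub_pos, one_sub_cascadedTail m hz.le]
  refine integral_pos_of_ae_pos ((integrable_const _).sub (integrable_exp_neg_div m hz.le)) ?_
  filter_upwards [ae_gammaLaw_pos m] with y hy
  rw [sub_pos, Real.exp_lt_one_iff, neg_div]
  exact neg_lt_zero.2 (div_pos hz hy)

/-- The tail of the cascaded gain in terms of the modified Bessel function. -/
theorem cascadedTail_eq_besselK (m : ℕ) {z : ℝ} (hz : 0 < z) :
    2 / Real.Gamma ((m + 1 : ℕ) : ℝ) * z ^ (((m + 1 : ℕ) : ℝ) / 2) * besselK (m + 1) (2 * √z) =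
      cascadedTail m z := by
  have hs : 0 < √z := Real.sqrt_pos.2 hz
  set h : ℝ → ℝ := fun u => √z ^ (m + 1) * (Real.exp ((m + 1 : ℕ) * u) *
    Real.exp (-(2 * √z) * Real.cosh u)) with hh
  have hderiv : ∀ u ∈ (Set.univ : Set ℝ), HasDerivWithinAt (fun u => √z * Real.exp u)
      (√z * Real.exp u) Set.univ u := fun u _ =>
    ((Real.hasDerivAt_exp u).const_mul _).hasDerivWithinAt
  have hinj : Set.InjOn (fun u => √z * Real.exp u) Set.univ := fun a _ b _ hab =>
    Real.exp_injective (mul_left_cancel₀ hs.ne' hab)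
  have himg : (fun u => √z * Real.exp u) '' Set.univ = Set.Ioi 0 := by
    ext y
    simp only [Set.image_univ, Set.mem_range, Set.mem_Ioi]
    constructor
    · rintro ⟨u, rfl⟩; positivity
    · intro hy
      refine ⟨Real.log (y / √z), ?_⟩
      rw [Real.exp_log (by positivity)]
      field_simp
  -- The substitution y = √z eᵘ makes the exponent symmetric: y + z/y = 2√z cosh u. The Jacobian
  -- raises the power from m to m+1.
  have hcomp : ∀ u : ℝ, |√z * Real.exp u| • ((√z * Real.exp u) ^ m *
      Real.exp (-(√z * Real.exp u)) * Real.exp (-z / (√z * Real.exp u))) = h u := by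
    intro u
    have h1 : -z / (√z * Real.exp u) = -(√z * Real.exp (-u)) := by
      rw [Real.exp_neg]
      have := Real.mul_self_sqrt hz.le
      field_simp
      nlinarith
    have h2 : -(2 * √z) * Real.cosh u = -(√z * Real.exp u) + -(√z * Real.exp (-u)) := by
      rw [Real.cosh_eq]; ring
    have h3 : Real.exp ((m + 1 : ℕ) * u) = Real.exp u ^ (m + 1) := Real.exp_nat_mul u (m + 1)
    rw [abs_of_pos (by positivity), hh]
    simp only [smul_eq_mul]
    rw [h1, h2, h3, Real.exp_add]
    ring
  have hint : Integrable h := by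
    rw [← integrableOn_univ]
    have h1 : IntegrableOn (fun y => y ^ m * Real.exp (-y) * Real.exp (-z / y)) (Set.Ioi 0) := by
      refine (integrableOn_pow_mul_exp_neg m).mono' (by fun_prop)
        ((ae_restrict_iff' measurableSet_Ioi).2 (ae_of_all _ fun y hy => ?_))
      have hy : 0 < y := hy
      rw [Real.norm_of_nonneg (by positivity)]
      exact mul_le_of_le_one_right (by positivity) (exp_neg_div_le_one hz.le hy)
    rw [← himg, integrableOn_image_iff_integrableOn_abs_deriv_smul MeasurableSet.univ hderiv
      hinj] at h1
    simpa only [hcomp] using h1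
  have hsub : ∫ y in Set.Ioi (0 : ℝ), y ^ m * Real.exp (-y) * Real.exp (-z / y) = ∫ u, h u := by
    rw [← himg, integral_image_eq_integral_abs_deriv_smul MeasurableSet.univ hderiv hinj,
      setIntegral_univ]
    simp only [hcomp]
  -- Adding the contributions of u and -u turns exp((m+1)u) into 2 cosh((m+1)u).
  have hfold : ∫ u, h u = 2 * √z ^ (m + 1) * besselK (m + 1) (2 * √z) := by
    rw [← integral_add_compl measurableSet_Ioi hint (s := Set.Ioi (0 : ℝ)), Set.compl_Ioi,
      ← neg_zero, ← integral_comp_neg_Ioi, neg_zero, ← integral_add hint.integrableOn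
      hint.comp_neg.integrableOn, besselK, ← integral_const_mul]
    refine setIntegral_congr_fun measurableSet_Ioi fun u _ => ?_
    simp only [hh]
    rw [Real.cosh_neg, Real.cosh_eq (((m + 1 : ℕ) : ℝ) * u), mul_neg]
    ring
  have hpow : z ^ (((m + 1 : ℕ) : ℝ) / 2) = √z ^ (m + 1) := by
    rw [Real.sqrt_eq_rpow, ← Real.rpow_natCast, ← Real.rpow_mul hz.le]
    congr 1
    ring
  have hW : cascadedTail m z = (∫ y in Set.Ioi (0 : ℝ), y ^ m * Real.exp (-y) *
      Real.exp (-z / y)) / m.factorial := by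
    rw [cascadedTail, integral_gammaLaw, ← integral_div]
    refine setIntegral_congr_fun measurableSet_Ioi fun y _ => ?_
    simp only [smul_eq_mul]
    ring
  rw [hW, hsub, hfold, hpow]
  push_cast
  rw [Real.Gamma_nat_eq_factorial]
  ring

/-! ### Behaviour of the distribution function of the cascaded gain at zero -/

/-- Integrability of 1/y needs shape at least 2, here m+2. This is what separates Q ≥ 2 from Q = 1.
-/
lemma integral_inv_gammaLaw_succ (m : ℕ) :
    Integrable (fun y => y⁻¹) (gammaLaw (m + 1)) ∧ ∫ y, y⁻¹ ∂gammaLaw (m + 1) = ((m : ℝ) + 1)⁻¹ := by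
  have e : ∀ y ∈ Set.Ioi (0 : ℝ), y ^ m * Real.exp (-y) * ((m + 1).factorial : ℝ)⁻¹ =
      (y ^ (m + 1) * Real.exp (-y) / (m + 1).factorial) • y⁻¹ := by
    intro y hy
    have : y ≠ 0 := ne_of_gt hy
    rw [smul_eq_mul]
    field_simp
    ring
  constructor
  · rw [integrable_gammaLaw_iff]
    exact IntegrableOn.congr_fun (Integrable.mul_const (integrableOn_pow_mul_exp_neg m) _) e
      measurableSet_Ioi
  · rw [integral_gammaLaw, ← setIntegral_congr_fun measurableSet_Ioi e, integral_mul_const,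
      integral_pow_mul_exp_neg, Nat.factorial_succ]
    push_cast
    field_simp

/-- The quotient (1 - exp(-s/y))/s tends to 1/y and is dominated by 1/y. -/
theorem isEquivalent_one_sub_cascadedTail_succ (m : ℕ) :
    Asymptotics.IsEquivalent (𝓝[>] 0) (fun s => 1 - cascadedTail (m + 1) s)
      fun s => s / ((m : ℝ) + 1) := by
  have hlim : Tendsto (fun s => ∫ y, (1 - Real.exp (-s / y)) / s ∂gammaLaw (m + 1)) (𝓝[>] 0)
      (𝓝 (∫ y, y⁻¹ ∂gammaLaw (m + 1))) := by
    refine tendsto_integral_filter_of_dominated_convergence (fun y => y⁻¹)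
      (Eventually.of_forall fun s => by fun_prop) ?_ (integral_inv_gammaLaw_succ m).1 ?_
    · filter_upwards [self_mem_nhdsWithin] with s hs
      have hs : 0 < s := hs
      filter_upwards [ae_gammaLaw_pos (m + 1)] with y hy
      have h1 := exp_neg_div_le_one hs.le hy
      have h2 := Real.add_one_le_exp (-s / y)
      rw [Real.norm_of_nonneg (div_nonneg (by linarith) hs.le), div_le_iff₀ hs]
      have : y⁻¹ * s = -(-s / y) := by ring
      linarith
    · filter_upwards [ae_gammaLaw_pos (m + 1)] with y hy
      have hd : HasDerivAt (fun s : ℝ => 1 - Real.exp (-s / y)) y⁻¹ 0 := by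
        have h := ((((hasDerivAt_id (0 : ℝ)).neg).div_const y).exp).const_sub 1
        refine h.congr_deriv ?_
        simp [neg_div]
      have h := (hasDerivAt_iff_tendsto_slope.1 hd).mono_left
        (nhdsWithin_mono 0 (fun x (hx : 0 < x) => hx.ne'))
      refine h.congr fun s => ?_
      simp [slope_def_field]
  rw [(integral_inv_gammaLaw_succ m).2] at hlim
  rw [Asymptotics.isEquivalent_iff_tendsto_one]
  · have h := hlim.mul_const ((m : ℝ) + 1)
    rw [inv_mul_cancel₀ (by positivity)] at h
    refine h.congr' ?_
    filter_upwards [self_mem_nhdsWithin] with s hs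
    have hs : 0 < s := hs
    rw [Pi.div_apply, one_sub_cascadedTail _ hs.le, integral_div]
    field_simp
  · filter_upwards [self_mem_nhdsWithin] with s hs
    have hs : 0 < s := hs
    positivity

lemma one_sub_cascadedTail_zero_eq {s : ℝ} (hs : 0 ≤ s) :
    1 - cascadedTail 0 s =
      ∫ y in Set.Ioi (0 : ℝ), Real.exp (-y) * (1 - Real.exp (-s / y)) := by
  rw [one_sub_cascadedTail _ hs, integral_gammaLaw]
  refine setIntegral_congr_fun measurableSet_Ioi fun y _ => ?_
  simp

lemma integrableOn_exp_neg_mul_one_sub {s : ℝ} (hs : 0 ≤ s) :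
    IntegrableOn (fun y => Real.exp (-y) * (1 - Real.exp (-s / y))) (Set.Ioi 0) := by
  refine (exp_neg_integrableOn_Ioi 0 one_pos).mono' (by fun_prop)
    ((ae_restrict_iff' measurableSet_Ioi).2 (ae_of_all _ fun y hy => ?_))
  have h1 := exp_neg_div_le_one hs hy
  have h2 := Real.exp_pos (-s / y)
  have h3 := Real.exp_pos (-y)
  rw [Real.norm_of_nonneg (mul_nonneg h3.le (by linarith)), neg_one_mul]
  nlinarith

/-- Split the integral at s and 1. The integrand is at most 1 on (0, s], at most s/y on (s, 1], and
at most s exp(-y) beyond; only the middle piece carries the logarithm. -/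
lemma one_sub_cascadedTail_zero_le {s : ℝ} (hs : 0 < s) (hs1 : s < 1) :
    1 - cascadedTail 0 s ≤ -(s * Real.log s) + 2 * s := by
  have hint := integrableOn_exp_neg_mul_one_sub hs.le
  have hb : ∀ y, 0 < y → 1 - Real.exp (-s / y) ≤ s / y ∧ 0 ≤ 1 - Real.exp (-s / y) ∧
      1 - Real.exp (-s / y) ≤ 1 := fun y hy => by
    have h1 := exp_neg_div_le_one hs.le hy
    have h2 := Real.add_one_le_exp (-s / y)
    have h3 := Real.exp_pos (-s / y)
    rw [neg_div] at *
    exact ⟨by linarith, by linarith, by linarith⟩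
  have hexp : ∀ y : ℝ, 0 < y → Real.exp (-y) ≤ 1 := fun y hy => by
    rw [Real.exp_le_one_iff]; linarith
  rw [one_sub_cascadedTail_zero_eq hs.le, ← Set.Ioc_union_Ioi_eq_Ioi zero_le_one,
    setIntegral_union (Set.Ioc_disjoint_Ioi le_rfl) measurableSet_Ioi
      (hint.mono_set Set.Ioc_subset_Ioi_self) (hint.mono_set (Set.Ioi_subset_Ioi zero_le_one)),
    ← Set.Ioc_union_Ioc_eq_Ioc hs.le hs1.le,
    setIntegral_union (Set.Ioc_disjoint_Ioc_of_le le_rfl) measurableSet_Ioc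
      (hint.mono_set Set.Ioc_subset_Ioi_self)
      (hint.mono_set (Set.Ioc_subset_Ioi_self.trans (Set.Ioi_subset_Ioi hs.le)))]
  have b1 : ∫ y in Set.Ioc 0 s, Real.exp (-y) * (1 - Real.exp (-s / y)) ≤ s := by
    calc _ ≤ ∫ y in Set.Ioc 0 s, (1 : ℝ) := by
          refine setIntegral_mono_on (hint.mono_set Set.Ioc_subset_Ioi_self)
            (integrableOn_const (by simp)) measurableSet_Ioc fun y hy => ?_
          have := hb y hy.1
          exact mul_le_one₀ (hexp y hy.1) this.2.1 this.2.2
      _ = s := by simp [hs.le]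
  have b2 : ∫ y in Set.Ioc s 1, Real.exp (-y) * (1 - Real.exp (-s / y)) ≤ -(s * Real.log s) := by
    have hinv : IntegrableOn (fun y : ℝ => s * y⁻¹) (Set.Ioc s 1) := by
      have := (intervalIntegral.intervalIntegrable_inv (a := s) (b := 1) (f := fun y : ℝ => y)
        (μ := volume) (fun y hy => ?_) continuousOn_id).const_mul s
      · exact (intervalIntegrable_iff_integrableOn_Ioc_of_le hs1.le).1 this
      · rw [Set.uIcc_of_le hs1.le] at hy
        exact (hs.trans_le hy.1).ne'
    calc _ ≤ ∫ y in Set.Ioc s 1, s * y⁻¹ := by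
          refine setIntegral_mono_on
            (hint.mono_set (Set.Ioc_subset_Ioi_self.trans (Set.Ioi_subset_Ioi hs.le)))
            hinv measurableSet_Ioc fun y hy => ?_
          have hy0 := hs.trans hy.1
          have := hb y hy0
          calc _ ≤ 1 * (1 - Real.exp (-s / y)) := by
                exact mul_le_mul_of_nonneg_right (hexp y hy0) this.2.1
            _ ≤ s * y⁻¹ := by rw [one_mul, ← div_eq_mul_inv]; exact this.1
      _ = -(s * Real.log s) := by
          rw [← intervalIntegral.integral_of_le hs1.le, intervalIntegral.integral_const_mul,
            integral_inv_of_pos hs one_pos, one_div, Real.log_inv]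
          ring
  have b3 : ∫ y in Set.Ioi 1, Real.exp (-y) * (1 - Real.exp (-s / y)) ≤ s := by
    calc _ ≤ ∫ y in Set.Ioi (1 : ℝ), s * Real.exp (-y) := by
          refine setIntegral_mono_on (hint.mono_set (Set.Ioi_subset_Ioi zero_le_one))
            ?_ measurableSet_Ioi fun y hy => ?_
          · have := (exp_neg_integrableOn_Ioi 1 one_pos).const_mul s
            simpa [IntegrableOn] using this
          · have hy : (1 : ℝ) < y := hy
            have := hb y (by linarith)
            rw [mul_comm]
            refine mul_le_mul_of_nonneg_right (this.1.trans ?_) (Real.exp_pos _).le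
            exact div_le_self hs.le hy.le
      _ = s * Real.exp (-1) := by rw [integral_const_mul, integral_exp_neg_Ioi]
      _ ≤ s := mul_le_of_le_one_right hs.le (hexp 1 one_pos)
  linarith

/-- On (0, 1], 1 - exp(-s/y) ≥ s/(y+s) and exp(-y) ≥ 1 - y, so the integrand is at least s/(y+s) -
s, which integrates to s ln((1+s)/s) - s. -/
lemma le_one_sub_cascadedTail_zero {s : ℝ} (hs : 0 < s) :
    -(s * Real.log s) - s ≤ 1 - cascadedTail 0 s := by
  have hint := integrableOn_exp_neg_mul_one_sub hs.le
  have hnn : ∀ y ∈ Set.Ioi (0 : ℝ), 0 ≤ Real.exp (-y) * (1 - Real.exp (-s / y)) := fun y hy =>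
    mul_nonneg (Real.exp_pos _).le (sub_nonneg.2 (exp_neg_div_le_one hs.le hy))
  have hinv : IntervalIntegrable (fun y : ℝ => s * (y + s)⁻¹ - s) volume 0 1 := by
    refine ContinuousOn.intervalIntegrable fun y hy => ?_
    rw [Set.uIcc_of_le zero_le_one] at hy
    have : y + s ≠ 0 := by linarith [hy.1]
    exact ContinuousAt.continuousWithinAt (by fun_prop (disch := assumption))
  rw [one_sub_cascadedTail_zero_eq hs.le]
  calc -(s * Real.log s) - s ≤ s * (Real.log (1 + s) - Real.log s) - s := by
        have := Real.log_nonneg (by linarith : 1 ≤ 1 + s)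
        nlinarith
    _ = ∫ y in (0 : ℝ)..1, (s * (y + s)⁻¹ - s) := by
        rw [intervalIntegral.integral_sub, intervalIntegral.integral_const_mul,
          intervalIntegral.integral_comp_add_right (fun y => y⁻¹),
          integral_inv_of_pos (by linarith) (by linarith), Real.log_div (by positivity)
          (by linarith)]
        · simp
        · simpa using hinv.add (intervalIntegrable_const (c := s))
        · exact intervalIntegrable_const
    _ = ∫ y in Set.Ioc (0 : ℝ) 1, (s * (y + s)⁻¹ - s) :=
        intervalIntegral.integral_of_le zero_le_one
    _ ≤ ∫ y in Set.Ioc (0 : ℝ) 1, Real.exp (-y) * (1 - Real.exp (-s / y)) := by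
        refine setIntegral_mono_on
          ((intervalIntegrable_iff_integrableOn_Ioc_of_le zero_le_one).1 hinv)
          (hint.mono_set Set.Ioc_subset_Ioi_self) measurableSet_Ioc fun y hy => ?_
        have hy0 := hy.1
        have h1 : s * (y + s)⁻¹ ≤ 1 - Real.exp (-s / y) := by
          have h2 : Real.exp (-s / y) ≤ (1 + s / y)⁻¹ := by
            rw [neg_div, Real.exp_neg]
            refine inv_anti₀ (by positivity) ?_
            linarith [Real.add_one_le_exp (s / y)]
          have h3 : (1 + s / y)⁻¹ = 1 - s * (y + s)⁻¹ := by field_simp; ring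
          linarith
        have h4 : 1 - y ≤ Real.exp (-y) := by linarith [Real.add_one_le_exp (-y)]
        have h5 : s * (y + s)⁻¹ * y ≤ s := by
          rw [mul_assoc]
          refine mul_le_of_le_one_right hs.le ?_
          rw [inv_mul_le_one₀ (by linarith)]
          linarith
        calc s * (y + s)⁻¹ - s ≤ (1 - y) * (s * (y + s)⁻¹) := by nlinarith
          _ ≤ Real.exp (-y) * (s * (y + s)⁻¹) :=
            mul_le_mul_of_nonneg_right h4 (by positivity)
          _ ≤ _ := mul_le_mul_of_nonneg_left h1 (Real.exp_pos _).le
    _ ≤ _ := setIntegral_mono_set hint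
        ((ae_restrict_iff' measurableSet_Ioi).2 (ae_of_all _ hnn))
        Set.Ioc_subset_Ioi_self.eventuallyLE

/-- The two bounds leave an error O(s), negligible against s ln s. -/
theorem isEquivalent_one_sub_cascadedTail_zero :
    Asymptotics.IsEquivalent (𝓝[>] 0) (fun s => 1 - cascadedTail 0 s)
      fun s => -(s * Real.log s) := by
  have h1 : (fun s => 1 - cascadedTail 0 s - -(s * Real.log s)) =O[𝓝[>] 0] fun s => s := by
    refine Asymptotics.IsBigO.of_bound 2 ?_
    filter_upwards [Ioo_mem_nhdsGT (zero_lt_one (α := ℝ))] with s hs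
    have h1 := one_sub_cascadedTail_zero_le hs.1 hs.2
    have h2 := le_one_sub_cascadedTail_zero hs.1
    rw [Real.norm_eq_abs, Real.norm_of_nonneg hs.1.le, abs_le]
    constructor <;> linarith [hs.1]
  have h2 : (fun s : ℝ => s) =o[𝓝[>] 0] fun s => -(s * Real.log s) := by
    have h3 : (fun _ : ℝ => (1 : ℝ)) =o[𝓝[>] 0] Real.log :=
      Asymptotics.isLittleO_const_left.2 (Or.inr
        (tendsto_abs_atBot_atTop.comp Real.tendsto_log_nhdsGT_zero))
    have h4 := ((Asymptotics.isBigO_refl (fun s : ℝ => s) (𝓝[>] 0)).mul_isLittleO h3).neg_right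
    simpa using h4
  exact h1.trans_isLittleO h2


namespace Network

variable {K : ℕ} (net : Network K)

/-! ### Thresholds -/

lemma tail_nonneg (k : Fin K) : 0 ≤ net.tail k := Finset.sum_nonneg fun i _ => net.a_nonneg i

lemma one_lt_two_rpow_R (k : Fin K) : 1 < (2 : ℝ) ^ net.R k :=
  Real.one_lt_rpow one_lt_two (net.R_pos k)

lemma Q_cast_pos : (0 : ℝ) < net.Q := by exact_mod_cast net.Q_pos

lemma meanEveGain_eq : net.meanEveGain = net.Q * net.Nbr * net.Nre := by
  obtain ⟨m, hm⟩ := Nat.exists_eq_succ_of_ne_zero (Nat.one_le_iff_ne_zero.1 net.Q_pos)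
  rw [meanEveGain, hm]
  exact integral_cascadedGainLaw net.p net.Nbr_pos net.Nre_pos

lemma eve_denominator_pos {ϖ : ℝ} (hϖ : 0 ≤ ϖ) (k : Fin K) {τ : ℝ} (hτ : 0 ≤ τ) :
    0 < net.ρe * net.Q * net.Nbr * net.Nre * net.tail k + ϖ * net.ρe * net.Nipe * τ + 1 := by
  have := net.tail_nonneg k
  have := net.Nbr_pos
  have := net.Nre_pos
  have := net.Nipe_pos
  have := net.ρe_pos
  have := net.Q_cast_pos
  positivity

lemma eta_pos {ϖ : ℝ} (hϖ : 0 ≤ ϖ) (k : Fin K) {τ : ℝ} (hτ : 0 ≤ τ) : 0 < net.eta ϖ k τ := by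
  have hd := net.eve_denominator_pos hϖ k hτ
  have h1 := net.one_lt_two_rpow_R k
  have := net.Nbr_pos
  have := net.Nre_pos
  have := net.ρe_pos
  have := net.Q_cast_pos
  have := net.a_nonneg k
  have h2 : 0 ≤ net.Q * net.Nbr * net.Nre * net.a k * net.ρe /
      (net.ρe * net.Q * net.Nbr * net.Nre * net.tail k + ϖ * net.ρe * net.Nipe * τ + 1) :=
    div_nonneg (by positivity) hd.le
  rw [eta]
  nlinarith

lemma eta_level_zero (k : Fin K) (τ : ℝ) : net.eta 0 k τ = net.psi k := by simp [eta, psi]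

/-- Interference only weakens the eavesdropper, so attainability at ψ implies it for every
interference level. -/
lemma eta_le_psi {ϖ : ℝ} (hϖ : 0 ≤ ϖ) (k : Fin K) {τ : ℝ} (hτ : 0 ≤ τ) :
    net.eta ϖ k τ ≤ net.psi k := by
  have hd := net.eve_denominator_pos le_rfl k (le_refl 0)
  have := net.Nbr_pos
  have := net.Nre_pos
  have := net.Nipe_pos
  have := net.ρe_pos
  have := net.Q_cast_pos
  have := net.a_nonneg k
  have h1 : 0 ≤ ϖ * net.ρe * net.Nipe * τ := by positivity
  rw [zero_mul, zero_mul, zero_mul, add_zero] at hd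
  rw [eta, psi]
  gcongr
  linarith

lemma eta_gap_pos {ϖ : ℝ} (hϖ : 0 ≤ ϖ) {k : Fin K} (hψ : net.psi k * net.tail k < net.a k)
    {τ : ℝ} (hτ : 0 ≤ τ) : 0 < net.a k - net.eta ϖ k τ * net.tail k := by
  have := mul_le_mul_of_nonneg_right (net.eta_le_psi hϖ k hτ) (net.tail_nonneg k)
  linarith

lemma continuous_eta_max {ϖ : ℝ} (hϖ : 0 ≤ ϖ) (k : Fin K) :
    Continuous fun τ => net.eta ϖ k (max τ 0) := by
  have h : ∀ τ : ℝ, net.ρe * net.Q * net.Nbr * net.Nre * net.tail k +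
      ϖ * net.ρe * net.Nipe * max τ 0 + 1 ≠ 0 := fun τ =>
    (net.eve_denominator_pos hϖ k (le_max_right _ _)).ne'
  unfold eta
  fun_prop (disch := exact h)

/-! ### The distribution function of the ordered gain -/

/-- The distribution function of the ordered gain of user `k`, normalised by the product of the
channel variances. -/
def gainCdf (k : Fin K) (z : ℝ) : ℝ :=
  binomialTail K k (1 - cascadedTail (net.Q - 1) (max z 0))

lemma continuous_gainCdf (k : Fin K) : Continuous (net.gainCdf k) :=
  (continuous_binomialTail K k).comp (continuous_const.sub (continuous_cascadedTail_max _))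

instance (k : Fin K) : IsProbabilityMeasure (net.userGainLaw k) := by
  unfold userGainLaw; infer_instance

lemma userGainLaw_real_Iio (k : Fin K) {x : ℝ} (hx : 0 ≤ x) :
    (net.userGainLaw k).real (Set.Iio x) = net.gainCdf k (x / (net.Nbr * net.Nr k)) := by
  obtain ⟨m, hm⟩ := Nat.exists_eq_succ_of_ne_zero (Nat.one_le_iff_ne_zero.1 net.Q_pos)
  have hN : 0 < net.Nbr * net.Nr k := mul_pos net.Nbr_pos (net.Nr_pos k)
  rw [userGainLaw, orderedLaw_real_Iio, gainCdf, max_eq_left (div_nonneg hx hN.le), hm,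
    cascadedGainLaw_real_Iio net.p net.Nbr_pos (net.Nr_pos k) hx]
  rfl

/-- Every value is a probability under `userGainLaw`, including the clipped value for negative z. -/
lemma gainCdf_mem_Icc (k : Fin K) (z : ℝ) : net.gainCdf k z ∈ Set.Icc (0 : ℝ) 1 := by
  have hN : 0 < net.Nbr * net.Nr k := mul_pos net.Nbr_pos (net.Nr_pos k)
  have h := net.userGainLaw_real_Iio k (mul_nonneg (le_max_right z 0) hN.le)
  have e : net.gainCdf k (max z 0) = net.gainCdf k z := by simp [gainCdf]
  rw [mul_div_cancel_right₀ _ hN.ne', e] at h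
  rw [← h]
  exact ⟨measureReal_nonneg, measureReal_le_one⟩

lemma gainCdf_pos (k : Fin K) {z : ℝ} (hz : 0 < z) : 0 < net.gainCdf k z := by
  rw [gainCdf, max_eq_left hz.le]
  exact binomialTail_pos k.2 (sub_pos.2 (cascadedTail_lt_one _ hz))
    (by linarith [cascadedTail_nonneg (net.Q - 1) z])

lemma ae_userGainLaw_nonneg (k : Fin K) : ∀ᵐ g ∂net.userGainLaw k, 0 ≤ g := by
  have h := net.userGainLaw_real_Iio k le_rfl
  rw [zero_div, gainCdf, max_self, cascadedTail_zero, sub_self, binomialTail_zero,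
    measureReal_eq_zero_iff] at h
  rw [ae_iff]
  simpa [Set.Iio] using h

lemma one_sub_besselK_eq {z : ℝ} (hz : 0 < z) :
    1 - 2 / Real.Gamma net.Q * z ^ ((net.Q : ℝ) / 2) * besselK net.Q (2 * √z) =
      1 - cascadedTail (net.Q - 1) z := by
  obtain ⟨m, hm⟩ := Nat.exists_eq_succ_of_ne_zero (Nat.one_le_iff_ne_zero.1 net.Q_pos)
  rw [hm]
  exact congrArg (1 - ·) (cascadedTail_eq_besselK m hz)

lemma gainCdf_eq_kappa_mul_sum (k : Fin K) {z : ℝ} (hz : 0 < z) :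
    net.gainCdf k z = net.kappa k * ∑ l ∈ Finset.range (K - (k + 1) + 1),
      ((K - (k + 1)).choose l : ℝ) * ((-1 : ℝ) ^ l / ((k : ℝ) + 1 + l)) *
        (1 - 2 / Real.Gamma net.Q * z ^ ((net.Q : ℝ) / 2) * besselK net.Q (2 * √z)) ^
          ((k : ℕ) + 1 + l) := by
  rw [one_sub_besselK_eq net hz, gainCdf, max_eq_left hz.le, binomialTail_eq_alternating_sum k.2]
  rfl

/-! ### The outage threshold on the normalised gain -/

/-- The threshold on the normalised gain of user `k`, where `δ` is the inverse of the transmit SNR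
and `σ`, `τ` are the normalised residual interference gains at the eavesdropper and at the user. -/
def gainThreshold (ϖ : ℝ) (k : Fin K) (δ σ τ : ℝ) : ℝ :=
  net.eta ϖ k σ * (ϖ * net.Nipu * τ + δ) /
    ((net.a k - net.eta ϖ k σ * net.tail k) * (net.Nbr * net.Nr k))

lemma gainThreshold_pos {ϖ : ℝ} (hϖ : 0 ≤ ϖ) {k : Fin K}
    (hψ : net.psi k * net.tail k < net.a k) {δ σ τ : ℝ} (hσ : 0 ≤ σ)
    (h : 0 < ϖ * net.Nipu * τ + δ) : 0 < net.gainThreshold ϖ k δ σ τ := by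
  have h1 := net.eta_pos hϖ k hσ
  have h2 := net.eta_gap_pos hϖ hψ hσ
  have h3 := net.Nbr_pos
  have h4 := net.Nr_pos k
  unfold gainThreshold
  positivity

lemma continuous_gainThreshold_max {ϖ : ℝ} (hϖ : 0 ≤ ϖ) {k : Fin K}
    (hψ : net.psi k * net.tail k < net.a k) (δ : ℝ) :
    Continuous fun x : ℝ × ℝ => net.gainThreshold ϖ k δ (max x.1 0) (max x.2 0) := by
  have h1 : Continuous fun x : ℝ × ℝ => net.eta ϖ k (max x.1 0) :=
    (net.continuous_eta_max hϖ k).comp continuous_fst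
  have h2 : ∀ x : ℝ × ℝ, (net.a k - net.eta ϖ k (max x.1 0) * net.tail k) *
      (net.Nbr * net.Nr k) ≠ 0 := fun x =>
    (mul_pos (net.eta_gap_pos hϖ hψ (le_max_right _ _))
      (mul_pos net.Nbr_pos (net.Nr_pos k))).ne'
  unfold gainThreshold
  fun_prop (disch := exact h2)

/-- The conditional outage probability as a bounded continuous function of the normalised residual
interference gains. -/
def conditionalOutage {ϖ : ℝ} (hϖ : 0 ≤ ϖ) {k : Fin K}
    (hψ : net.psi k * net.tail k < net.a k) (δ : ℝ) : BoundedContinuousFunction (ℝ × ℝ) ℝ :=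
  BoundedContinuousFunction.ofNormedAddCommGroup
    (fun x => net.gainCdf k (net.gainThreshold ϖ k δ (max x.1 0) (max x.2 0)))
    ((net.continuous_gainCdf k).comp (net.continuous_gainThreshold_max hϖ hψ δ)) 1
    (fun x => by
      have h := net.gainCdf_mem_Icc k (net.gainThreshold ϖ k δ (max x.1 0) (max x.2 0))
      rw [Real.norm_of_nonneg h.1]
      exact h.2)

lemma conditionalOutage_apply {ϖ : ℝ} (hϖ : 0 ≤ ϖ) {k : Fin K}
    (hψ : net.psi k * net.tail k < net.a k) (δ : ℝ) {x : ℝ × ℝ} (h1 : 0 ≤ x.1) (h2 : 0 ≤ x.2) :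
    net.conditionalOutage hϖ hψ δ x = net.gainCdf k (net.gainThreshold ϖ k δ x.1 x.2) := by
  change net.gainCdf k (net.gainThreshold ϖ k δ (max x.1 0) (max x.2 0)) = _
  rw [max_eq_left h1, max_eq_left h2]

/-! ### The secrecy outage event -/

/-- Since R_k > 0 the positive part is irrelevant, and monotonicity of the logarithm leaves γ_k < η.
This is linear in g once denominators are cleared, and the positive gap a_k - ην_k lets it be solved
for g. -/
lemma secrecyRate_lt_iff {ϖ ρ : ℝ} (hϖ : 0 ≤ ϖ) (hρ : 0 < ρ) {k : Fin K}
    (hψ : net.psi k * net.tail k < net.a k) {g y e : ℝ} (hg : 0 ≤ g) (hy : 0 ≤ y) (he : 0 ≤ e) :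
    secrecyRate (net.userSINR ϖ ρ k g y) (net.eveSINR ϖ k net.meanEveGain e) < net.R k ↔
      g < net.gainThreshold ϖ k ρ⁻¹ (e / net.Nipe) (y / net.Nipu) * (net.Nbr * net.Nr k) := by
  have hpe := net.Nipe_pos
  have hpu := net.Nipu_pos
  have hN : 0 < net.Nbr * net.Nr k := mul_pos net.Nbr_pos (net.Nr_pos k)
  have ha := net.a_nonneg k
  have hν := net.tail_nonneg k
  have hσ : 0 ≤ e / net.Nipe := div_nonneg he hpe.le
  have hη := net.eta_pos hϖ k hσ
  have hgap := net.eta_gap_pos hϖ hψ hσ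
  have hden := net.eve_denominator_pos hϖ k hσ
  have h2R : 0 < (2 : ℝ) ^ net.R k := by positivity
  set η := net.eta ϖ k (e / net.Nipe) with hηdef
  -- The computed mean gain Q N_br N_re enters here and identifies η as the SINR threshold.
  have heve : (2 : ℝ) ^ net.R k * (1 + net.eveSINR ϖ k net.meanEveGain e) = 1 + η := by
    rw [hηdef, eta, eveSINR, meanEveGain_eq]
    have e1 : ϖ * net.ρe * net.Nipe * (e / net.Nipe) = ϖ * net.ρe * e := by
      field_simp
    have e2 : net.ρe * (net.Q * net.Nbr * net.Nre) * net.tail k + ϖ * net.ρe * e + 1 =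
        net.ρe * net.Q * net.Nbr * net.Nre * net.tail k + ϖ * net.ρe * e + 1 := by ring
    rw [e1, e2]
    ring
  have heve_pos : 0 < 1 + net.eveSINR ϖ k net.meanEveGain e := by
    refine pos_of_mul_pos_right (a := (2 : ℝ) ^ net.R k) ?_ h2R.le
    rw [heve]
    linarith
  have hD : 0 < ρ * g * net.tail k + ϖ * ρ * y + 1 := by positivity
  have huser : 0 ≤ net.userSINR ϖ ρ k g y := div_nonneg (by positivity) hD.le
  have hlog : Real.logb 2 (1 + η) =
      net.R k + Real.logb 2 (1 + net.eveSINR ϖ k net.meanEveGain e) := by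
    rw [← heve, Real.logb_mul h2R.ne' heve_pos.ne', Real.logb_rpow two_pos (by norm_num)]
  rw [secrecyRate, max_lt_iff, and_iff_left (net.R_pos k), sub_lt_iff_lt_add, ← hlog,
    Real.logb_lt_logb_iff one_lt_two (by linarith) (by linarith), add_lt_add_iff_left, userSINR,
    div_lt_iff₀ hD]
  have hthr : net.gainThreshold ϖ k ρ⁻¹ (e / net.Nipe) (y / net.Nipu) * (net.Nbr * net.Nr k) =
      η * (ϖ * y + ρ⁻¹) / (net.a k - η * net.tail k) := by
    rw [gainThreshold, ← hηdef, div_mul_eq_mul_div, mul_div_mul_right _ _ hN.ne', mul_assoc ϖ,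
      mul_div_cancel₀ _ hpu.ne']
  rw [hthr, lt_div_iff₀ hgap]
  have hmul : η * (ρ * g * net.tail k + ϖ * ρ * y + 1) - ρ * g * net.a k =
      ρ * (η * (ϖ * y + ρ⁻¹) - g * (net.a k - η * net.tail k)) := by
    field_simp
    ring
  rw [← sub_pos, hmul, mul_pos_iff_of_pos_left hρ, sub_pos]

lemma measurableSet_outage (ϖ ρ : ℝ) (k : Fin K) :
    MeasurableSet {z : ℝ × ℂ × ℂ |
      secrecyRate (net.userSINR ϖ ρ k z.1 (‖z.2.1‖ ^ 2))
        (net.eveSINR ϖ k net.meanEveGain (‖z.2.2‖ ^ 2)) < net.R k} := by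
  unfold secrecyRate userSINR eveSINR Real.logb
  exact measurableSet_lt (by fun_prop) measurable_const

/-- The coordinates are swapped: the outage event lists the user's interference first, whereas the
quadrature variables (σ, τ) start with the eavesdropper. -/
lemma map_normSq_prod {N N' : ℝ} (hN : 0 < N) (hN' : 0 < N') :
    ((complexGaussian N).prod (complexGaussian N')).map
      (fun w : ℂ × ℂ => (‖w.2‖ ^ 2 / N', ‖w.1‖ ^ 2 / N)) = (gammaLaw 0).prod (gammaLaw 0) := by
  have h1 : Measurable fun z : ℂ => ‖z‖ ^ 2 / N := by fun_prop
  have h2 : Measurable fun z : ℂ => ‖z‖ ^ 2 / N' := by fun_prop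
  have h := Measure.map_prod_map (complexGaussian N') (complexGaussian N) h2 h1
  rw [map_normSq_complexGaussian hN, map_normSq_complexGaussian hN'] at h
  rw [h, ← Measure.prod_swap, Measure.map_map (by fun_prop) measurable_swap]
  rfl

/-- By Fubini, condition on both interference channels; the inner probability is F at the threshold.
-/
lemma SOP_eq_integral {ϖ ρ : ℝ} (hϖ : 0 ≤ ϖ) (hρ : 0 < ρ) {k : Fin K}
    (hψ : net.psi k * net.tail k < net.a k) :
    net.SOP ϖ k ρ =
      ∫ x, net.conditionalOutage hϖ hψ ρ⁻¹ x ∂(gammaLaw 0).prod (gammaLaw 0) := by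
  have hN : 0 < net.Nbr * net.Nr k := mul_pos net.Nbr_pos (net.Nr_pos k)
  rw [SOP, measureReal_prod_eq_integral_symm _ _ (net.measurableSet_outage ϖ ρ k),
    ← map_normSq_prod net.Nipu_pos net.Nipe_pos, integral_map (by fun_prop)
      (net.conditionalOutage hϖ hψ ρ⁻¹).continuous.aestronglyMeasurable]
  refine integral_congr_ae (ae_of_all _ fun w => ?_)
  have hy : 0 ≤ ‖w.1‖ ^ 2 / net.Nipu := div_nonneg (sq_nonneg _) net.Nipu_pos.le
  have hσ : 0 ≤ ‖w.2‖ ^ 2 / net.Nipe := div_nonneg (sq_nonneg _) net.Nipe_pos.le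
  have hpos : 0 < net.gainThreshold ϖ k ρ⁻¹ (‖w.2‖ ^ 2 / net.Nipe) (‖w.1‖ ^ 2 / net.Nipu) := by
    have := net.Nipu_pos
    exact net.gainThreshold_pos hϖ hψ hσ (by positivity)
  have h := net.userGainLaw_real_Iio k (mul_pos hpos hN).le
  rw [mul_div_cancel_right₀ _ hN.ne'] at h
  simp only
  rw [net.conditionalOutage_apply hϖ hψ _ hσ hy, ← h]
  -- The description of the event is valid for g ≥ 0 only, so the two sets are compared up to a null
  -- set.
  refine measureReal_congr ?_
  filter_upwards [net.ae_userGainLaw_nonneg k] with g hg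
  exact propext (net.secrecyRate_lt_iff hϖ hρ hψ hg (sq_nonneg _) (sq_nonneg _))

end Network


namespace Network

variable {K : ℕ} (net : Network K)

/-! ### Imperfect SIC -/

lemma zeta1_arg_eq (ϖ : ℝ) {ρ : ℝ} (hρ : ρ ≠ 0) (k : Fin K) (σ τ : ℝ) :
    net.eta ϖ k σ * net.zeta1 ϖ ρ k τ / (net.a k - net.eta ϖ k σ * net.tail k) =
      net.gainThreshold ϖ k ρ⁻¹ σ τ := by
  have e : net.zeta1 ϖ ρ k τ = (ϖ * net.Nipu * τ + ρ⁻¹) / (net.Nbr * net.Nr k) := by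
    rw [zeta1, mul_assoc ρ, ← div_div]
    congr 1
    field_simp
  rw [e, gainThreshold, ← mul_div_assoc, div_div, mul_comm (net.Nbr * net.Nr k)]

/-- The asymptotic formula is the finite-SNR formula at δ = 0, so its limit becomes continuity in δ.
-/
lemma asymptotic_arg_eq (ϖ : ℝ) (k : Fin K) (σ τ : ℝ) :
    net.eta ϖ k σ * net.Nipu * ϖ * τ /
      ((net.a k - net.eta ϖ k σ * net.tail k) * net.Nbr * net.Nr k) =
      net.gainThreshold ϖ k 0 σ τ := by
  rw [gainThreshold, mul_assoc (net.a k - net.eta ϖ k σ * net.tail k)]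
  congr 1
  ring

/-- At each pair of nodes the sum over l reassembles F. Positivity of z is required by the Bessel
representation. -/
lemma sum_quadrature_eq (k : Fin K) (S D : ℕ) (z : ℝ → ℝ → ℝ)
    (hz : ∀ σ ∈ laguerreNodes S, ∀ τ ∈ laguerreNodes D, 0 < z σ τ) :
    ∑ σ ∈ laguerreNodes S, ∑ l ∈ Finset.range (K - (k + 1) + 1), ∑ τ ∈ laguerreNodes D,
      net.kappa k * laguerreWeight S σ * laguerreWeight D τ *
        ((K - (k + 1)).choose l : ℝ) * ((-1 : ℝ) ^ l / ((k : ℝ) + 1 + l)) *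
        (1 - 2 / Real.Gamma net.Q * (z σ τ) ^ ((net.Q : ℝ) / 2) *
          besselK net.Q (2 * √(z σ τ))) ^ ((k : ℕ) + 1 + l) =
    ∑ σ ∈ laguerreNodes S, ∑ τ ∈ laguerreNodes D,
      laguerreWeight S σ * laguerreWeight D τ * net.gainCdf k (z σ τ) := by
  refine Finset.sum_congr rfl fun σ hσ => ?_
  rw [Finset.sum_comm]
  refine Finset.sum_congr rfl fun τ hτ => ?_
  rw [net.gainCdf_eq_kappa_mul_sum k (hz σ hσ τ hτ), Finset.mul_sum, Finset.mul_sum]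
  refine Finset.sum_congr rfl fun l _ => ?_
  ring

lemma interference_pos {ϖ : ℝ} (hϖ : 0 < ϖ) {τ δ : ℝ} (hτ : 0 < τ) (hδ : 0 ≤ δ) :
    0 < ϖ * net.Nipu * τ + δ := by
  have := net.Nipu_pos
  positivity

lemma sopIpSIC_eq {ϖ ρ : ℝ} (hϖ : 0 < ϖ) (hρ : 0 < ρ) {k : Fin K}
    (hψ : net.psi k * net.tail k < net.a k) (S D : ℕ) :
    net.sopIpSIC ϖ k S D ρ = ∑ σ ∈ laguerreNodes S, ∑ τ ∈ laguerreNodes D,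
      laguerreWeight S σ * laguerreWeight D τ * net.conditionalOutage hϖ.le hψ ρ⁻¹ (σ, τ) := by
  simp only [sopIpSIC, net.zeta1_arg_eq ϖ hρ.ne']
  rw [net.sum_quadrature_eq k S D (fun σ τ => net.gainThreshold ϖ k ρ⁻¹ σ τ) fun σ hσ τ hτ =>
    net.gainThreshold_pos hϖ.le hψ (laguerreNodes_pos hσ).le
      (net.interference_pos hϖ (laguerreNodes_pos hτ) (inv_pos.2 hρ).le)]
  refine Finset.sum_congr rfl fun σ hσ => Finset.sum_congr rfl fun τ hτ => ?_
  rw [net.conditionalOutage_apply hϖ.le hψ _ (laguerreNodes_pos hσ).le (laguerreNodes_pos hτ).le]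

lemma asySopIpSIC_eq {ϖ : ℝ} (hϖ : 0 < ϖ) {k : Fin K}
    (hψ : net.psi k * net.tail k < net.a k) (S D : ℕ) :
    net.asySopIpSIC ϖ k S D = ∑ σ ∈ laguerreNodes S, ∑ τ ∈ laguerreNodes D,
      laguerreWeight S σ * laguerreWeight D τ * net.conditionalOutage hϖ.le hψ 0 (σ, τ) := by
  simp only [asySopIpSIC, net.asymptotic_arg_eq ϖ]
  rw [net.sum_quadrature_eq k S D (fun σ τ => net.gainThreshold ϖ k 0 σ τ) fun σ hσ τ hτ =>
    net.gainThreshold_pos hϖ.le hψ (laguerreNodes_pos hσ).le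
      (net.interference_pos hϖ (laguerreNodes_pos hτ) le_rfl)]
  refine Finset.sum_congr rfl fun σ hσ => Finset.sum_congr rfl fun τ hτ => ?_
  rw [net.conditionalOutage_apply hϖ.le hψ _ (laguerreNodes_pos hσ).le (laguerreNodes_pos hτ).le]

lemma conditionalOutage_pos {ϖ : ℝ} (hϖ : 0 < ϖ) {k : Fin K}
    (hψ : net.psi k * net.tail k < net.a k) {x : ℝ × ℝ} (h1 : 0 < x.1) (h2 : 0 < x.2) :
    0 < net.conditionalOutage hϖ.le hψ 0 x := by
  rw [net.conditionalOutage_apply hϖ.le hψ _ h1.le h2.le]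
  exact net.gainCdf_pos k (net.gainThreshold_pos hϖ.le hψ h1.le (net.interference_pos hϖ h2 le_rfl))

lemma tendsto_conditionalOutage {ϖ : ℝ} (hϖ : 0 ≤ ϖ) {k : Fin K}
    (hψ : net.psi k * net.tail k < net.a k) (x : ℝ × ℝ) :
    Tendsto (fun ρ : ℝ => net.conditionalOutage hϖ hψ ρ⁻¹ x) atTop
      (𝓝 (net.conditionalOutage hϖ hψ 0 x)) := by
  have h : Continuous fun δ : ℝ =>
      net.gainCdf k (net.gainThreshold ϖ k δ (max x.1 0) (max x.2 0)) := by
    refine (net.continuous_gainCdf k).comp ?_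
    unfold gainThreshold
    fun_prop
  exact (h.tendsto 0).comp tendsto_inv_atTop_zero

theorem tendsto_sopIpSIC {ϖ : ℝ} (hϖ : 0 < ϖ) {k : Fin K}
    (hψ : net.psi k * net.tail k < net.a k) (S D : ℕ) :
    Tendsto (fun ρ : ℝ => net.sopIpSIC ϖ k S D ρ) atTop (𝓝 (net.asySopIpSIC ϖ k S D)) := by
  rw [net.asySopIpSIC_eq hϖ hψ]
  refine Tendsto.congr' ?_ (tendsto_finsetSum _ fun σ _ => tendsto_finsetSum _ fun τ _ =>
    (net.tendsto_conditionalOutage hϖ.le hψ (σ, τ)).const_mul _)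
  filter_upwards [eventually_gt_atTop 0] with ρ hρ
  exact (net.sopIpSIC_eq hϖ hρ hψ S D).symm

theorem asySopIpSIC_pos {ϖ : ℝ} (hϖ : 0 < ϖ) {k : Fin K}
    (hψ : net.psi k * net.tail k < net.a k) {S D : ℕ} (hS : 1 ≤ S) (hD : 1 ≤ D) :
    0 < net.asySopIpSIC ϖ k S D := by
  have hne : ∀ {n : ℕ}, 1 ≤ n → (laguerreNodes n).Nonempty := fun {n} hn => by
    rw [← Finset.card_pos, card_laguerreNodes]
    exact hn
  rw [net.asySopIpSIC_eq hϖ hψ]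
  exact Finset.sum_pos (fun σ hσ => Finset.sum_pos (fun τ hτ =>
    mul_pos (mul_pos (laguerreWeight_pos hσ) (laguerreWeight_pos hτ))
      (net.conditionalOutage_pos hϖ hψ (laguerreNodes_pos hσ) (laguerreNodes_pos hτ)))
    (hne hD)) (hne hS)

theorem tendsto_SOP {ϖ : ℝ} (hϖ : 0 < ϖ) {k : Fin K} (hψ : net.psi k * net.tail k < net.a k) :
    Tendsto (fun ρ : ℝ => net.SOP ϖ k ρ) atTop
      (𝓝 (∫ x, net.conditionalOutage hϖ.le hψ 0 x ∂(gammaLaw 0).prod (gammaLaw 0))) := by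
  have h : Tendsto (fun ρ : ℝ =>
      ∫ x, net.conditionalOutage hϖ.le hψ ρ⁻¹ x ∂(gammaLaw 0).prod (gammaLaw 0)) atTop
      (𝓝 (∫ x, net.conditionalOutage hϖ.le hψ 0 x ∂(gammaLaw 0).prod (gammaLaw 0))) := by
    refine tendsto_integral_filter_of_dominated_convergence (fun _ => 1)
      (Eventually.of_forall fun ρ =>
        (net.conditionalOutage hϖ.le hψ ρ⁻¹).continuous.aestronglyMeasurable)
      (Eventually.of_forall fun ρ => ae_of_all _ fun x => ?_) (integrable_const _)
      (ae_of_all _ fun x => net.tendsto_conditionalOutage hϖ.le hψ x)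
    have h := net.gainCdf_mem_Icc k (net.gainThreshold ϖ k ρ⁻¹ (max x.1 0) (max x.2 0))
    exact (Real.norm_of_nonneg h.1).trans_le h.2
  refine h.congr' ?_
  filter_upwards [eventually_gt_atTop 0] with ρ hρ
  exact (net.SOP_eq_integral hϖ.le hρ hψ).symm

lemma integral_conditionalOutage_pos {ϖ : ℝ} (hϖ : 0 < ϖ) {k : Fin K}
    (hψ : net.psi k * net.tail k < net.a k) :
    0 < ∫ x, net.conditionalOutage hϖ.le hψ 0 x ∂(gammaLaw 0).prod (gammaLaw 0) := by
  refine integral_pos_of_ae_pos (BoundedContinuousFunction.integrable _ _) ?_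
  filter_upwards [Measure.quasiMeasurePreserving_fst.ae (ae_gammaLaw_pos 0),
    Measure.quasiMeasurePreserving_snd.ae (ae_gammaLaw_pos 0)] with x h1 h2
  exact net.conditionalOutage_pos hϖ hψ h1 h2

theorem tendsto_asySopIpSIC {ϖ : ℝ} (hϖ : 0 < ϖ) {k : Fin K}
    (hψ : net.psi k * net.tail k < net.a k) :
    Tendsto (fun n : ℕ × ℕ => net.asySopIpSIC ϖ k n.1 n.2) atTop
      (𝓝 (∫ x, net.conditionalOutage hϖ.le hψ 0 x ∂(gammaLaw 0).prod (gammaLaw 0))) := by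
  simp only [net.asySopIpSIC_eq hϖ hψ]
  exact tendsto_sum_laguerreWeight_sum_laguerreWeight _

/-! ### Perfect SIC -/

/-- Without residual interference the threshold does not depend on σ or τ, so averaging over them is
trivial. -/
lemma gainThreshold_level_zero (k : Fin K) (ρ σ τ : ℝ) :
    net.gainThreshold 0 k ρ⁻¹ σ τ = net.sPsi k ρ := by
  rw [gainThreshold, sPsi, eta_level_zero, zero_mul, zero_mul, zero_add, mul_assoc ρ, mul_inv,
    ← div_div, ← div_div, mul_div_assoc, mul_div_assoc, mul_div_assoc, div_right_comm]
  ring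

lemma sPsi_pos {k : Fin K} (hψ : net.psi k * net.tail k < net.a k) {ρ : ℝ} (hρ : 0 < ρ) :
    0 < net.sPsi k ρ := by
  rw [← net.gainThreshold_level_zero k ρ 0 0]
  exact net.gainThreshold_pos le_rfl hψ le_rfl (by simpa using hρ)

lemma tendsto_sPsi {k : Fin K} (hψ : net.psi k * net.tail k < net.a k) :
    Tendsto (fun ρ : ℝ => net.sPsi k ρ) atTop (𝓝[>] 0) := by
  rw [tendsto_nhdsWithin_iff]
  constructor
  · have h := (tendsto_inv_atTop_zero (𝕜 := ℝ)).const_mul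
      (net.psi k / (net.Nbr * net.Nr k) / (net.a k - net.psi k * net.tail k))
    rw [mul_zero] at h
    refine h.congr fun ρ => ?_
    rw [sPsi, mul_assoc ρ, mul_inv]
    ring
  · filter_upwards [eventually_gt_atTop 0] with ρ hρ
    exact net.sPsi_pos hψ hρ

lemma sopPSIC_eq {k : Fin K} (hψ : net.psi k * net.tail k < net.a k) {ρ : ℝ} (hρ : 0 < ρ) :
    net.sopPSIC k ρ = net.gainCdf k (net.sPsi k ρ) :=
  (net.gainCdf_eq_kappa_mul_sum k (net.sPsi_pos hψ hρ)).symm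

/-- With perfect SIC the closed form of the secrecy outage probability is exact. -/
theorem SOP_level_zero_eq {k : Fin K} (hψ : net.psi k * net.tail k < net.a k) {ρ : ℝ}
    (hρ : 0 < ρ) : net.SOP 0 k ρ = net.gainCdf k (net.sPsi k ρ) := by
  rw [net.SOP_eq_integral le_rfl hρ hψ]
  have h : ∀ x, net.conditionalOutage le_rfl hψ ρ⁻¹ x = net.gainCdf k (net.sPsi k ρ) := fun x =>
    congrArg (net.gainCdf k) (net.gainThreshold_level_zero k ρ _ _)
  simp [h]

/-- Compose the leading term of the binomial tail with the unordered distribution function along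
s(ψ). Both inner maps must tend to 0 through positive values, hence the one-sided filters. -/
lemma isEquivalent_gainCdf_sPsi {k : Fin K} (hψ : net.psi k * net.tail k < net.a k) {v : ℝ → ℝ}
    (hv : Asymptotics.IsEquivalent (𝓝[>] 0) (fun s => 1 - cascadedTail (net.Q - 1) s) v) :
    Asymptotics.IsEquivalent atTop (fun ρ => net.gainCdf k (net.sPsi k ρ))
      fun ρ => net.kappa k / ((k : ℝ) + 1) * (v (net.sPsi k ρ)) ^ ((k : ℕ) + 1) := by
  have hs := net.tendsto_sPsi hψ
  have hp : Tendsto (fun s => 1 - cascadedTail (net.Q - 1) s) (𝓝[>] 0) (𝓝[>] 0) := by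
    rw [tendsto_nhdsWithin_iff]
    constructor
    · have hc : Continuous fun z => 1 - cascadedTail (net.Q - 1) (max z 0) :=
        continuous_const.sub (continuous_cascadedTail_max _)
      have h := hc.tendsto 0
      rw [max_self, cascadedTail_zero, sub_self] at h
      refine (h.mono_left nhdsWithin_le_nhds).congr' ?_
      filter_upwards [self_mem_nhdsWithin] with s hs
      rw [max_eq_left (le_of_lt hs)]
    · filter_upwards [self_mem_nhdsWithin] with s hs
      exact sub_pos.2 (cascadedTail_lt_one _ hs)
  have h1 := (isEquivalent_binomialTail k.2).comp_tendsto (hp.comp hs)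
  have h2 := (Asymptotics.IsEquivalent.refl (u := fun _ : ℝ => net.kappa k / ((k : ℝ) + 1))
    (l := atTop)).mul ((hv.comp_tendsto hs).pow ((k : ℕ) + 1))
  refine Asymptotics.IsEquivalent.trans ?_ h2
  refine h1.congr_left ?_
  filter_upwards [eventually_gt_atTop 0] with ρ hρ
  simp only [Function.comp_apply, gainCdf]
  rw [max_eq_left (net.sPsi_pos hψ hρ).le]

theorem isEquivalent_asySopPSICOne {k : Fin K} (hψ : net.psi k * net.tail k < net.a k)
    (hQ : net.Q = 1) :
    Asymptotics.IsEquivalent atTop (fun ρ => net.gainCdf k (net.sPsi k ρ))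
      fun ρ => net.asySopPSICOne k ρ := by
  have h := net.isEquivalent_gainCdf_sPsi hψ (v := fun s => -(s * Real.log s))
    (by rw [hQ]; exact isEquivalent_one_sub_cascadedTail_zero)
  refine h.congr_right (Eventually.of_forall fun ρ => ?_)
  -- As Γ(1) = 1, the bracket 1 - (1 + s ln s) is -s ln s.
  simp [asySopPSICOne, hQ]

theorem isEquivalent_asySopPSICTwo {k : Fin K} (hψ : net.psi k * net.tail k < net.a k)
    (hQ : 2 ≤ net.Q) :
    Asymptotics.IsEquivalent atTop (fun ρ => net.gainCdf k (net.sPsi k ρ))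
      fun ρ => net.asySopPSICTwo k ρ := by
  obtain ⟨m, hm⟩ := Nat.exists_eq_add_of_le' hQ
  have h := net.isEquivalent_gainCdf_sPsi hψ (v := fun s => s / ((m : ℝ) + 1))
    (by rw [hm]; exact isEquivalent_one_sub_cascadedTail_succ m)
  refine h.congr_right (Eventually.of_forall fun ρ => ?_)
  have e : (net.Q : ℝ) - 1 = m + 1 := by rw [hm]; push_cast; ring
  simp only [asySopPSICTwo, e]

end Network

end RISNOMA

end

/-! ### High-SNR limits and equivalents of the secrecy outage probability -/

theorem corollary1 {K : ℕ} (net : RISNOMA.Network K) (k : Fin K)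
    (hψ : net.psi k * net.tail k < net.a k) :
    -- imperfect SIC
    (∀ ϖ : ℝ, 0 < ϖ →
      (∀ S D : ℕ, Filter.Tendsto (fun ρ : ℝ => net.sopIpSIC ϖ k S D ρ) Filter.atTop
        (nhds (net.asySopIpSIC ϖ k S D))) ∧
      (∀ S D : ℕ, 1 ≤ S → 1 ≤ D → 0 < net.asySopIpSIC ϖ k S D) ∧
      (∃ L : ℝ, 0 < L ∧
        Filter.Tendsto (fun ρ : ℝ => net.SOP ϖ k ρ) Filter.atTop (nhds L) ∧
        Filter.Tendsto (fun n : ℕ × ℕ => net.asySopIpSIC ϖ k n.1 n.2) Filter.atTop (nhds L))) ∧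
    -- perfect SIC
    (net.Q = 1 →
      Asymptotics.IsEquivalent Filter.atTop (fun ρ : ℝ => net.sopPSIC k ρ)
        (fun ρ : ℝ => net.asySopPSICOne k ρ) ∧
      Asymptotics.IsEquivalent Filter.atTop (fun ρ : ℝ => net.SOP 0 k ρ)
        (fun ρ : ℝ => net.asySopPSICOne k ρ)) ∧
    (2 ≤ net.Q →
      Asymptotics.IsEquivalent Filter.atTop (fun ρ : ℝ => net.sopPSIC k ρ)
        (fun ρ : ℝ => net.asySopPSICTwo k ρ) ∧
      Asymptotics.IsEquivalent Filter.atTop (fun ρ : ℝ => net.SOP 0 k ρ)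
        (fun ρ : ℝ => net.asySopPSICTwo k ρ)) := by
  have hclosed : (fun ρ => net.gainCdf k (net.sPsi k ρ)) =ᶠ[atTop] fun ρ => net.sopPSIC k ρ := by
    filter_upwards [eventually_gt_atTop 0] with ρ hρ
    exact (net.sopPSIC_eq hψ hρ).symm
  have hSOP : (fun ρ => net.gainCdf k (net.sPsi k ρ)) =ᶠ[atTop] fun ρ => net.SOP 0 k ρ := by
    filter_upwards [eventually_gt_atTop 0] with ρ hρ
    exact (net.SOP_level_zero_eq hψ hρ).symm
  refine ⟨fun ϖ hϖ => ⟨net.tendsto_sopIpSIC hϖ hψ, fun S D => net.asySopIpSIC_pos hϖ hψ,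
    _, net.integral_conditionalOutage_pos hϖ hψ, net.tendsto_SOP hϖ hψ,
    net.tendsto_asySopIpSIC hϖ hψ⟩, fun hQ => ?_, fun hQ => ?_⟩
  · have h := net.isEquivalent_asySopPSICOne hψ hQ
    exact ⟨h.congr_left hclosed, h.congr_left hSOP⟩
  · have h := net.isEquivalent_asySopPSICTwo hψ hQ
    exact ⟨h.congr_left hclosed, h.congr_left hSOP⟩
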